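/- Let $\mathbb{R}^n$ carry its usual Euclidean structure. For $\delta>0$ and a bounded set $A\subset\mathbb{R}^n$ let $\mathcal{N}_\delta(A)$ be the minimal number of closed balls of radius $\delta$ needed to cover $A$; let $B(x,\rho)$ be the closed ball of center $x$ and radius $\rho$; let $\mathrm{Gr}(\mathbb{R}^n,m)$ be the Grassmannian of $m$-dimensional linear subspaces of $\mathbb{R}^n$, with its Borel $\sigma$-algebra, and for $V\in\mathrm{Gr}(\mathbb{R}^n,m)$ let $\pi_V$ be the orthogonal projection onto $V$. For $V\in\mathrm{Gr}(\mathbb{R}^n,m)$ and $W\in\mathrm{Gr}(\mathbb{R}^n,n-m)$ put $d_\angle(V,W)=|\det(v_1,\dots,v_m,w_1,\dots,w_{n-m})|$, where $(v_i)$ and $(w_j)$ are orthonormal bases of $V$ and $W$, and for $\rho\ge 0$ let $\mathcal{V}_\angle(W,\rho)=\{V\in\mathrm{Gr}(\mathbb{R}^n,m) : d_\angle(V,W)\le\rho\}$. For $\alpha,\epsilon>0$ and bounded $A\subset\mathbb{R}^n$ let \[\mathcal{E}(A,\epsilon)=\{V\in\mathrm{Gr}(\mathbb{R}^n,m) : \exists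 A'\subset A,\ \mathcal{N}_\delta(A')\ge\delta^{\epsilon}\mathcal{N}_\delta(A)\text{ and }\mathcal{N}_\delta(\pi_V(A'))<\delta^{-\frac mn\alpha-\epsilon}\}.\] For integers $0<m<n$ let $\mathrm{T}(n,m)$ be the following assertion. For all $0<\alpha<n$ and $\kappa>0$ there is $\epsilon>0$ such that for all sufficiently small $\delta>0$ (depending only on $n,m,\alpha,\kappa,\epsilon$), for every subset $A\subset B(0,1)\subset\mathbb{R}^n$ and every probability measure $\mu$ on $\mathrm{Gr}(\mathbb{R}^n,m)$ that satisfy \[\mathcal{N}_\delta(A)\ge\delta^{-\alpha+\epsilon},\] \[\forall\rho\ge\delta,\ \forall x\in\mathbb{R}^n,\quad \mathcal{N}_\delta(A\cap B(x,\rho))\le\delta^{-\epsilon}\rho^{\kappa}\mathcal{N}_\delta(A),\] \[\forall\rho\ge\delta,\ \forall W\in\mathrm{Gr}(\mathbb{R}^n,n-m),\quad \mu(\mathcal{V}_\angle(W,\rho))\le\delta^{-\epsilon}\rho^{\kappa},\] there is a subset $A'\subset A$ such that $\mu(\mathcal{E}(A',\epsilon))\le\delta^{\epsilon}$ (if $\mathcal{E}(A',\epsilon)$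 is not measurable, $\mu$ denotes the outer measure). Proposition. Let $0<m<n$ be integers such that $n=q(n-m)+r$, where $q\ge 1$ and $0<r\le n-m$ are integers. If $\mathrm{T}(n,r)$ holds, then $\mathrm{T}(n,m)$ holds. -/

import Mathlib

open scoped Topology

noncomputable section

namespace DiscProj

/-- `ℝⁿ` with its usual Euclidean structure. -/
abbrev E (n : ℕ) : Type := EuclideanSpace ℝ (Fin n)

/-- The Grassmannian of `m`-dimensional linear subspaces of `ℝⁿ`. -/
def Gr (n m : ℕ) : Type := {V : Submodule ℝ (E n) // Module.finrank ℝ V = m}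

/-- The orthogonal projection `π_V : ℝⁿ → V`, with values regarded as elements of `ℝⁿ`. -/
def Gr.proj {n m : ℕ} (V : Gr n m) : E n →L[ℝ] E n := V.1.starProjection

/-- The usual topology of the Grassmannian: the one that makes `V ↦ π_V` an embedding into the
space of linear endomorphisms. -/
instance (n m : ℕ) : TopologicalSpace (Gr n m) :=
  TopologicalSpace.induced Gr.proj inferInstance

/-- The Grassmannian carries its Borel `σ`-algebra. -/
instance (n m : ℕ) : MeasurableSpace (Gr n m) := borel (Gr n m)

instance (n m : ℕ) : BorelSpace (Gr n m) := ⟨rfl⟩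

/-- Some orthonormal basis of a point of the Grassmannian. -/
def Gr.onb {n m : ℕ} (V : Gr n m) : OrthonormalBasis (Fin m) ℝ V.1 :=
  (stdOrthonormalBasis ℝ V.1).reindex (finCongr V.2)

/-- The square matrix whose columns are the vectors `v₁, …, v_m, w₁, …, w_{n-m}`. -/
def colMatrix {n m : ℕ} (v : Fin m → E n) (w : Fin (n - m) → E n) : Matrix (Fin n) (Fin n) ℝ :=
  Matrix.of fun i j =>
    if h : (j : ℕ) < m then v ⟨j, h⟩ i else w ⟨(j : ℕ) - m, by omega⟩ i

/-- `d_∠(V, W) = |det(v₁, …, v_m, w₁, …, w_{n-m})|`, where the `vᵢ` form an orthonormal basis of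
`V` and the `wⱼ` form an orthonormal basis of `W`; the value does not depend on the bases, see
`dang_eq`. -/
def dang {n m : ℕ} (V : Gr n m) (W : Gr n (n - m)) : ℝ :=
  |(colMatrix (fun a => (V.onb a : E n)) (fun b => (W.onb b : E n))).det|

/-- `d_∠(V, W)` may be computed in any orthonormal bases of `V` and of `W`. -/
theorem dang_eq {n m : ℕ} (V : Gr n m) (W : Gr n (n - m)) (v : OrthonormalBasis (Fin m) ℝ V.1)
    (w : OrthonormalBasis (Fin (n - m)) ℝ W.1) :
    dang V W = |(colMatrix (fun a => (v a : E n)) (fun b => (w b : E n))).det| := by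
  have hmn : m ≤ n := by
    have h1 := Submodule.finrank_le V.1
    rw [V.2] at h1
    simpa using h1
  let e : Fin n ≃ Fin m ⊕ Fin (n - m) :=
    (finCongr (by omega : n = m + (n - m))).trans finSumFinEquiv.symm
  have key : ∀ (x : Fin m → E n) (y : Fin (n - m) → E n),
      colMatrix x y = (Matrix.of fun (i : Fin n) s => Sum.elim x y s i).submatrix id e := by
    intro x y
    ext i j
    by_cases h : (j : ℕ) < m
    · have : e j = Sum.inl ⟨j, h⟩ := by
        rw [← Equiv.eq_symm_apply]; ext; simp [e]
      simp [colMatrix, h, this]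
    · have : e j = Sum.inr ⟨(j : ℕ) - m, by omega⟩ := by
        rw [← Equiv.eq_symm_apply]; ext; simp [e]; omega
      simp [colMatrix, h, this]
  have exp : ∀ {k : ℕ} (U : Submodule ℝ (E n)) (a b : OrthonormalBasis (Fin k) ℝ U) (j : Fin k)
      (i : Fin n), (b j : E n) i = ∑ l, (a l : E n) i * a.toBasis.toMatrix b l j := by
    intro k U a b j i
    have h1 := congrArg (fun u : U => (u : E n) i) (a.toBasis.sum_toMatrix_smul_self b j)
    simp only [Submodule.coe_sum, WithLp.ofLp_sum, Finset.sum_apply, Submodule.coe_smul,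
      PiLp.smul_apply, smul_eq_mul, OrthonormalBasis.coe_toBasis] at h1
    rw [← h1]
    exact Finset.sum_congr rfl fun l _ => mul_comm _ _
  have hmul : colMatrix (fun a => (v a : E n)) (fun b => (w b : E n)) =
      colMatrix (fun a => (V.onb a : E n)) (fun b => (W.onb b : E n)) *
        (Matrix.fromBlocks (V.onb.toBasis.toMatrix v) 0 0 (W.onb.toBasis.toMatrix w)).submatrix
          e e := by
    rw [key, key, Matrix.submatrix_mul_equiv]
    congr 1
    ext i s
    rw [Matrix.mul_apply, Fintype.sum_sum_type]
    rcases s with s | s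
    · simpa using exp V.1 V.onb v s i
    · simpa using exp W.1 W.onb w s i
  have habs : ∀ {k : ℕ} (U : Submodule ℝ (E n)) (a b : OrthonormalBasis (Fin k) ℝ U),
      |(a.toBasis.toMatrix b).det| = 1 := by
    intro k U a b
    rw [← Module.Basis.det_apply]
    rcases a.det_to_matrix_orthonormalBasis_real b with h | h <;> rw [h] <;> simp
  rw [hmul, Matrix.det_mul, Matrix.det_submatrix_equiv_self, Matrix.det_fromBlocks_zero₂₁,
    abs_mul, abs_mul, habs, habs, dang]
  simp

/-- The set of all `V ∈ Gr(ℝⁿ, m)` such that `d_∠(V, W) ≤ ρ`. -/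
def Vang {n m : ℕ} (W : Gr n (n - m)) (ρ : ℝ) : Set (Gr n m) := {V | dang V W ≤ ρ}

/-- The minimal number of closed balls of radius `δ` of `ℝⁿ` needed to cover `A` (meant for bounded
`A` and `δ > 0`, where it is finite). -/
def cov {n : ℕ} (δ : ℝ) (A : Set (E n)) : ℕ :=
  (Metric.externalCoveringNumber δ.toNNReal A).toNat

/-- The set of exceptional directions of `A`, for the parameters `α`, `ε`, at scale `δ`. -/
def exceptional (n m : ℕ) (α ε δ : ℝ) (A : Set (E n)) : Set (Gr n m) :=
  {V | ∃ A' ⊆ A, δ ^ ε * (cov δ A : ℝ) ≤ (cov δ A' : ℝ) ∧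
    (cov δ (V.proj '' A') : ℝ) < δ ^ (-((m : ℝ) / n * α) - ε)}

/-- The discretized projection theorem (in the form with a subset `A'`), as an assertion about the
pair of dimensions `(n, m)`. The set of exceptional directions need not be Borel for an arbitrary
set `A'`; its measure is then the outer measure, as always in Mathlib. -/
def ProjectionTheorem (n m : ℕ) : Prop :=
  ∀ α κ : ℝ, 0 < α → α < n → 0 < κ →
    ∃ ε : ℝ, 0 < ε ∧ ∃ δ₀ : ℝ, 0 < δ₀ ∧ ∀ δ : ℝ, 0 < δ → δ < δ₀ →
      ∀ (A : Set (E n)) (μ : MeasureTheory.Measure (Gr n m)),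
        A ⊆ Metric.closedBall 0 1 →
        MeasureTheory.IsProbabilityMeasure μ →
        δ ^ (-α + ε) ≤ (cov δ A : ℝ) →
        (∀ ρ : ℝ, δ ≤ ρ → ∀ x : E n,
          (cov δ (A ∩ Metric.closedBall x ρ) : ℝ) ≤ δ ^ (-ε) * ρ ^ κ * (cov δ A : ℝ)) →
        (∀ ρ : ℝ, δ ≤ ρ → ∀ W : Gr n (n - m),
          μ (Vang W ρ) ≤ ENNReal.ofReal (δ ^ (-ε) * ρ ^ κ)) →
        ∃ A' ⊆ A, μ (exceptional n m α ε δ A') ≤ ENNReal.ofReal (δ ^ ε)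

end DiscProj

end

/-!
The theorem descends from `T(n, r)` by intersecting independent random subspaces. If `V₁, …, V_q`
are independent with law `μ`, then `V₁ ∩ ⋯ ∩ V_q` generically has dimension `n - q (n - m) = r`.

*Submodularity.* For transverse `U` and `V`, a bounded set `A` has a subset `A'` of comparable
covering number such that `N(A) N(π_{U ∩ V} A') ≲ N(π_U A) N(π_V A)`
(`exists_subset_cov_mul_cov_inf_le`): on a fibre of `π_{U ∩ V}` the two projections are jointly
almost injective, and Cauchy-Schwarz sums this over the fibres. If the projections to `V` and `U`
have the exponents `mα/n` and `aα/n`, and `A` has the exponent `α`, then the projection to `U ∩ V`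
has the exponent `mα/n + aα/n - α = (dim (U ∩ V)) α/n`. So exceptional directions `U` and `V` yield
an exceptional direction `U ∩ V` (`exists_mem_exceptional_of_inf`). If every subset of `A` has many
exceptional `m`-dimensional directions, then `V` may be chosen after `U`, for the subset of `A` that
witnesses `U`; hence every large subset of `A` has many exceptional `r`-dimensional directions for
the law of the intersection (`IntersectionLaw.inter`).

*Non-concentration.* Instead of `dang` the argument uses the predicate `Transversal`, a lower bound
for the angle between two subspaces. If `U` is transverse to a subspace `W' ⊆ W` of complementary
dimension, and `V` is transverse to `U ∩ W`, then `U ∩ V` is transverse to `W`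
(`Transversal.inf`). So by Fubini the law of the intersection inherits non-concentration, with a
smaller exponent. That this law is a Borel measure at all depends on the measurability of
`(U, V) ↦ U ∩ V` (`Gr.measurable_inter`).

*Size of the subset.* `T(n, r)` gives a subset of `A` with few exceptional directions, but says
nothing about its size, whereas submodularity gains only on subsets of exponent close to `α`.
Exhausting `A` by such subsets lying in different grid cells produces one whose covering number is
comparable to that of `A` (`ProjectionTheorem.exists_large_subset`). It has both few and many
exceptional directions, a contradiction.

The sets of exceptional directions need not be measurable, so all estimates of their measures from
below go through measurable hulls (`mul_le_map_prod`).
-/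

open Filter MeasureTheory
open scoped Topology ENNReal Matrix

noncomputable section

namespace DiscProj

/-! ### Covering numbers and grid cells -/

section

variable {n : ℕ} {δ : ℝ}

/-- The cell containing `x` in the cubic grid of side `δ / n`; with this side a cell has diameter at
most `δ`, so that a single ball of radius `δ` covers it. -/
def cell (δ : ℝ) (x : E n) : Fin n → ℤ := fun i => ⌊x i * n / δ⌋

/-- The number of grid cells (at scale `δ`) that meet `A`. Unlike the covering number, it is exactly
additive over sets that share no cell. -/
def cells (δ : ℝ) (A : Set (E n)) : ℕ := (cell δ '' A).ncard

lemma cell_mem_Icc (hδ : 0 < δ) {x c : E n} {R : ℝ} {k : ℕ} (hx : ‖x - c‖ ≤ R)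
    (hk : n * R / δ ≤ k) :
    cell δ x ∈ Set.Icc (cell δ c - fun _ => (k : ℤ)) (cell δ c + fun _ => (k : ℤ)) := by
  have key : ∀ i, |x i * n / δ - c i * n / δ| ≤ k := by
    intro i
    have h1 : |x i - c i| ≤ R := by
      have := PiLp.norm_apply_le (x - c) i
      simp only [PiLp.sub_apply, Real.norm_eq_abs] at this
      exact this.trans hx
    have h2 : x i * n / δ - c i * n / δ = (x i - c i) * (n / δ) := by ring
    rw [h2, abs_mul, abs_of_nonneg (by positivity : (0 : ℝ) ≤ n / δ)]
    calc |x i - c i| * (n / δ) ≤ R * (n / δ) := by gcongr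
      _ = n * R / δ := by ring
      _ ≤ k := hk
  constructor <;> intro i <;> have h := abs_le.1 (key i)
  · have : ⌊c i * n / δ - (k : ℤ)⌋ ≤ ⌊x i * n / δ⌋ := Int.floor_mono (by push_cast; linarith)
    simpa [cell, Int.floor_sub_intCast] using this
  · have : ⌊x i * n / δ⌋ ≤ ⌊c i * n / δ + (k : ℤ)⌋ := Int.floor_mono (by push_cast; linarith)
    simpa [cell, Int.floor_add_intCast] using this

lemma ncard_Icc_cell (c : Fin n → ℤ) (k : ℕ) :
    (Set.Icc (c - fun _ => (k : ℤ)) (c + fun _ => (k : ℤ))).ncard = (2 * k + 1) ^ n := by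
  rw [← Finset.coe_Icc, Set.ncard_coe_finset, Pi.card_Icc]
  have : ∀ i, (Finset.Icc ((c - fun _ => (k : ℤ) : Fin n → ℤ) i)
      ((c + fun _ => (k : ℤ) : Fin n → ℤ) i)).card
      = 2 * k + 1 := by
    intro i
    rw [Int.card_Icc]
    simp only [Pi.add_apply, Pi.sub_apply]
    omega
  rw [Finset.prod_congr rfl fun i _ => this i]
  simp

lemma cells_le_of_forall_norm_sub_le (hδ : 0 < δ) {A : Set (E n)} {c : E n} {R : ℝ} {k : ℕ}
    (hA : ∀ x ∈ A, ‖x - c‖ ≤ R) (hk : n * R / δ ≤ k) :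
    (cell δ '' A).Finite ∧ cells δ A ≤ (2 * k + 1) ^ n := by
  have hsub : cell δ '' A ⊆
      Set.Icc (cell δ c - fun _ => (k : ℤ)) (cell δ c + fun _ => (k : ℤ)) := by
    rintro _ ⟨x, hx, rfl⟩
    exact cell_mem_Icc hδ (hA x hx) hk
  refine ⟨(Set.finite_Icc _ _).subset hsub, ?_⟩
  rw [← ncard_Icc_cell (cell δ c) k]
  exact Set.ncard_le_ncard hsub (Set.finite_Icc _ _)

lemma finite_cell_image (hδ : 0 < δ) {A : Set (E n)} (hA : Bornology.IsBounded A) :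
    (cell δ '' A).Finite := by
  obtain ⟨R, hR⟩ := hA.subset_closedBall (0 : E n)
  obtain ⟨k, hk⟩ := exists_nat_ge (n * R / δ)
  have h : ∀ x ∈ A, ‖x - 0‖ ≤ R := fun x hx => by
    rw [← dist_eq_norm]
    exact hR hx
  exact (cells_le_of_forall_norm_sub_le hδ h hk).1

lemma cells_mono (hδ : 0 < δ) {A B : Set (E n)} (h : A ⊆ B) (hB : Bornology.IsBounded B) :
    cells δ A ≤ cells δ B :=
  Set.ncard_le_ncard (Set.image_mono h) (finite_cell_image hδ hB)

lemma cells_union_le (A B : Set (E n)) : cells δ (A ∪ B) ≤ cells δ A + cells δ B := by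
  unfold cells
  rw [Set.image_union]
  exact Set.ncard_union_le _ _

lemma cells_union_of_disjoint (hδ : 0 < δ) {A B : Set (E n)} (hA : Bornology.IsBounded A)
    (hB : Bornology.IsBounded B) (h : Disjoint (cell δ '' A) (cell δ '' B)) :
    cells δ (A ∪ B) = cells δ A + cells δ B := by
  unfold cells
  rw [Set.image_union]
  exact Set.ncard_union_eq h (finite_cell_image hδ hA) (finite_cell_image hδ hB)

lemma dist_le_of_cell_eq (hδ : 0 < δ) {x y : E n} (h : cell δ x = cell δ y) : dist x y ≤ δ := by
  rcases Nat.eq_zero_or_pos n with rfl | hn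
  · rw [Subsingleton.elim x y, dist_self]; exact hδ.le
  have hn' : (0 : ℝ) < n := by exact_mod_cast hn
  have key : ∀ i, dist (x i) (y i) ≤ δ / n := by
    intro i
    have h1 := Int.abs_sub_lt_one_of_floor_eq_floor (congrFun h i)
    have h2 : x i * n / δ - y i * n / δ = (x i - y i) * (n / δ) := by ring
    rw [h2, abs_mul, abs_of_pos (by positivity : (0 : ℝ) < n / δ)] at h1
    rw [Real.dist_eq, le_div_iff₀ hn']
    have h3 : |x i - y i| * (n / δ) * δ = |x i - y i| * n := by field_simp
    nlinarith
  rw [EuclideanSpace.dist_eq]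
  apply Real.sqrt_le_iff.2 ⟨hδ.le, ?_⟩
  calc ∑ i, dist (x i) (y i) ^ 2 ≤ ∑ _i : Fin n, (δ / n) ^ 2 :=
        Finset.sum_le_sum fun i _ => pow_le_pow_left₀ dist_nonneg (key i) 2
    _ = δ ^ 2 / n := by simp; field_simp
    _ ≤ δ ^ 2 := div_le_self (by positivity) (by exact_mod_cast hn)

lemma externalCoveringNumber_le_cells (hδ : 0 < δ) {A : Set (E n)}
    (hA : Bornology.IsBounded A) :
    Metric.externalCoveringNumber δ.toNNReal A ≤ cells δ A := by
  obtain ⟨S, hSA, hS⟩ := (Set.surjOn_image (cell δ) A).exists_bijOn_subset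
  have hcov : Metric.IsCover δ.toNNReal A S := by
    rw [Metric.isCover_iff_subset_iUnion_closedBall]
    intro x hx
    obtain ⟨y, hy, hxy⟩ := hS.surjOn (Set.mem_image_of_mem _ hx)
    simp only [Set.mem_iUnion, Metric.mem_closedBall, Real.coe_toNNReal _ hδ.le]
    exact ⟨y, hy, dist_le_of_cell_eq hδ hxy.symm⟩
  refine hcov.externalCoveringNumber_le_encard.trans ?_
  rw [cells, (finite_cell_image hδ hA).cast_ncard_eq, ← hS.image_eq,
    hS.injOn.encard_image]

lemma cov_le_cells (hδ : 0 < δ) {A : Set (E n)} (hA : Bornology.IsBounded A) :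
    cov δ A ≤ cells δ A := by
  have h := externalCoveringNumber_le_cells hδ hA
  exact ENat.toNat_le_of_le_natCast h

lemma cells_le_cov (hδ : 0 < δ) {A : Set (E n)} (hA : Bornology.IsBounded A) :
    cells δ A ≤ (2 * n + 1) ^ n * cov δ A := by
  have hlt : Metric.externalCoveringNumber δ.toNNReal A ≠ ⊤ :=
    ne_top_of_le_ne_top (ENat.natCast_ne_top _) (externalCoveringNumber_le_cells hδ hA)
  obtain ⟨S, hS, hcard⟩ : ∃ S, Metric.IsCover δ.toNNReal A S ∧
      S.encard ≤ Metric.externalCoveringNumber δ.toNNReal A := by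
    by_contra! hcon
    have : Metric.externalCoveringNumber δ.toNNReal A + 1 ≤
        Metric.externalCoveringNumber δ.toNNReal A := by
      conv_rhs => unfold Metric.externalCoveringNumber
      exact le_iInf₂ fun S hS => Order.add_one_le_of_lt (hcon S hS)
    exact absurd this (not_le.2 ((ENat.lt_add_one_iff hlt).2 le_rfl))
  have hSfin : S.Finite := Set.encard_ne_top_iff.1 (ne_top_of_le_ne_top hlt hcard)
  rw [Metric.isCover_iff_subset_iUnion_closedBall, Real.coe_toNNReal _ hδ.le] at hS
  have hball : ∀ c : E n, cells δ (A ∩ Metric.closedBall c δ) ≤ (2 * n + 1) ^ n := fun c =>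
    (cells_le_of_forall_norm_sub_le hδ (c := c) (R := δ)
      (fun x hx => by simpa [dist_eq_norm] using hx.2)
      (by rw [mul_div_assoc, div_self hδ.ne', mul_one])).2
  have hsub : cell δ '' A ⊆ ⋃ c ∈ hSfin.toFinset, cell δ '' (A ∩ Metric.closedBall c δ) := by
    rintro _ ⟨x, hx, rfl⟩
    have := hS hx
    simp only [Set.mem_iUnion] at this
    obtain ⟨c, hc, hxc⟩ := this
    simp only [Set.mem_iUnion]
    exact ⟨c, by simpa using hc, x, ⟨hx, hxc⟩, rfl⟩
  have hfin : (⋃ c ∈ hSfin.toFinset, cell δ '' (A ∩ Metric.closedBall c δ)).Finite :=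
    Set.Finite.biUnion (Finset.finite_toSet _) fun c _ =>
      (finite_cell_image hδ hA).subset (Set.image_mono Set.inter_subset_left)
  calc cells δ A ≤ (⋃ c ∈ hSfin.toFinset, cell δ '' (A ∩ Metric.closedBall c δ)).ncard :=
        Set.ncard_le_ncard hsub hfin
    _ ≤ ∑ c ∈ hSfin.toFinset, (cell δ '' (A ∩ Metric.closedBall c δ)).ncard :=
        Finset.set_ncard_biUnion_le _ _
    _ ≤ ∑ _c ∈ hSfin.toFinset, (2 * n + 1) ^ n := Finset.sum_le_sum fun c _ => hball c
    _ = (2 * n + 1) ^ n * S.ncard := by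
        rw [Finset.sum_const, smul_eq_mul, mul_comm, Set.ncard_eq_toFinset_card S hSfin]
    _ ≤ (2 * n + 1) ^ n * cov δ A := by
        gcongr
        exact ENat.toNat_le_toNat hcard hlt

lemma cov_mono (hδ : 0 < δ) {A B : Set (E n)} (h : A ⊆ B) (hB : Bornology.IsBounded B) :
    cov δ A ≤ cov δ B :=
  ENat.toNat_le_toNat (Metric.externalCoveringNumber_mono_set h)
    (ne_top_of_le_ne_top (ENat.natCast_ne_top _) (externalCoveringNumber_le_cells hδ hB))

lemma cells_pos (hδ : 0 < δ) {A : Set (E n)} (hA : Bornology.IsBounded A) (hne : A.Nonempty) :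
    0 < cells δ A :=
  (Set.ncard_pos (finite_cell_image hδ hA)).2 (hne.image _)

end

/-! ### A submodularity inequality for covering numbers -/

lemma sum_card_image_fiber_le {ι β γ : Type*} [DecidableEq β] [DecidableEq γ] (X : Finset ι)
    (F : ι → β) (G : ι → γ) (hF : ∀ x ∈ X, ∀ y ∈ X, F x = F y → G x = G y) :
    ∑ z ∈ X.image G, (((X.filter fun x => G x = z).image F).card : ℝ) ≤ (X.image F).card := by
  have hdis : (X.image G : Set γ).PairwiseDisjoint
      fun z => (X.filter fun x => G x = z).image F := by
    intro z _ z' _ hzz'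
    rw [Function.onFun, Finset.disjoint_left]
    intro a ha ha'
    simp only [Finset.mem_image, Finset.mem_filter] at ha ha'
    obtain ⟨x, ⟨hx, rfl⟩, rfl⟩ := ha
    obtain ⟨y, ⟨hy, rfl⟩, hyx⟩ := ha'
    exact hzz' (hF x hx y hy hyx.symm)
  have hle : ((X.image G).biUnion fun z => (X.filter fun x => G x = z).image F).card ≤
      (X.image F).card := by
    refine Finset.card_le_card (Finset.biUnion_subset.2 fun z _ => ?_)
    exact Finset.image_subset_image (Finset.filter_subset _ _)
  rw [Finset.card_biUnion hdis] at hle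
  exact_mod_cast hle

/-- Combinatorial submodularity: if `F₁` and `F₂` both refine `G` and jointly have fibres of size
at most `D`, then at least half of `X` has an image under `G` of size at most
`2 D |F₁(X)| |F₂(X)| / |X|`. The half consists of the large fibres of `G`. -/
lemma exists_subset_card_mul_card_image_le {ι β₁ β₂ γ : Type*} [DecidableEq ι] [DecidableEq β₁]
    [DecidableEq β₂] [DecidableEq γ] (X : Finset ι) (F₁ : ι → β₁) (F₂ : ι → β₂) (G : ι → γ)
    (h₁ : ∀ x ∈ X, ∀ y ∈ X, F₁ x = F₁ y → G x = G y)
    (h₂ : ∀ x ∈ X, ∀ y ∈ X, F₂ x = F₂ y → G x = G y) (D : ℕ)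
    (hD : ∀ a b, (X.filter fun x => F₁ x = a ∧ F₂ x = b).card ≤ D) :
    ∃ X' ⊆ X, X.card ≤ 2 * X'.card ∧
      (X.card : ℝ) * (X'.image G).card ≤ 2 * D * (X.image F₁).card * (X.image F₂).card := by
  rcases X.eq_empty_or_nonempty with rfl | hX
  · exact ⟨∅, by simp⟩
  let fib : γ → Finset ι := fun z => X.filter fun x => G x = z
  obtain ⟨s, hsdef⟩ : ∃ s : γ → ℝ, ∀ z, s z = (fib z).card := ⟨_, fun _ => rfl⟩
  obtain ⟨p, hpdef⟩ : ∃ p : γ → ℝ, ∀ z, p z = ((fib z).image F₁).card := ⟨_, fun _ => rfl⟩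
  obtain ⟨r, hrdef⟩ : ∃ r : γ → ℝ, ∀ z, r z = ((fib z).image F₂).card := ⟨_, fun _ => rfl⟩
  have hp0 : ∀ z, 0 ≤ p z := fun z => by rw [hpdef]; positivity
  have hr0 : ∀ z, 0 ≤ r z := fun z => by rw [hrdef]; positivity
  let Z := X.image G
  have hp : ∑ z ∈ Z, p z ≤ (X.image F₁).card := by
    simp only [hpdef]
    exact sum_card_image_fiber_le X F₁ G h₁
  have hr : ∑ z ∈ Z, r z ≤ (X.image F₂).card := by
    simp only [hrdef]
    exact sum_card_image_fiber_le X F₂ G h₂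
  have hs : ∀ z, s z ≤ D * (p z * r z) := by
    intro z
    have h := Finset.card_le_mul_card_image_of_maps_to (s := fib z)
      (f := fun x => (F₁ x, F₂ x)) (t := (fib z).image F₁ ×ˢ (fib z).image F₂)
      (fun x hx => Finset.mem_product.2 ⟨Finset.mem_image_of_mem _ hx,
        Finset.mem_image_of_mem _ hx⟩) D ?_
    · rw [Finset.card_product] at h
      rw [hsdef, hpdef, hrdef]
      exact_mod_cast h
    · rintro ⟨a, b⟩ _
      refine (Finset.card_le_card ?_).trans (hD a b)
      intro x
      simp only [fib, Finset.mem_filter, Prod.mk.injEq]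
      tauto
  let S := ∑ z ∈ Z, √(s z)
  have hs0 : ∀ z ∈ Z, 1 ≤ s z := by
    intro z hz
    obtain ⟨x, hx, rfl⟩ := Finset.mem_image.1 hz
    have : 0 < (fib (G x)).card := Finset.card_pos.2 ⟨x, by simp [fib, hx]⟩
    rw [hsdef]
    exact Nat.one_le_cast.2 this
  have hSpos : 0 < S := by
    refine Finset.sum_pos (fun z hz => Real.sqrt_pos.2 (by linarith [hs0 z hz])) (hX.image G)
  have hS2 : S ^ 2 ≤ D * ((X.image F₁).card * (X.image F₂).card) := by
    have h1 : S ≤ √D * ∑ z ∈ Z, √(p z) * √(r z) := by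
      rw [Finset.mul_sum]
      refine Finset.sum_le_sum fun z _ => ?_
      rw [← Real.sqrt_mul (hp0 z), ← Real.sqrt_mul (by positivity)]
      exact Real.sqrt_le_sqrt (hs z)
    have h2 := Real.sum_sqrt_mul_sqrt_le Z (f := p) (g := r) hp0 hr0
    have h3 : S ≤ √(D * ((X.image F₁).card * (X.image F₂).card)) := by
      rw [Real.sqrt_mul (by positivity), Real.sqrt_mul (by positivity)]
      refine h1.trans (mul_le_mul_of_nonneg_left (h2.trans ?_) (by positivity))
      exact mul_le_mul (Real.sqrt_le_sqrt hp) (Real.sqrt_le_sqrt hr) (by positivity)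
        (by positivity)
    calc S ^ 2 ≤ √(D * ((X.image F₁).card * (X.image F₂).card)) ^ 2 := by gcongr
      _ = _ := Real.sq_sqrt (by positivity)
  let X' := X.filter fun x => (X.card : ℝ) ≤ 2 * S * √(s (G x))
  have hcompl : ((X.filter fun x => ¬ (X.card : ℝ) ≤ 2 * S * √(s (G x))).card : ℝ) ≤
      X.card / 2 := by
    set Y := X.filter fun x => ¬ (X.card : ℝ) ≤ 2 * S * √(s (G x)) with hY
    have hYZ : ∀ z ∈ Z, ((Y.filter fun x => G x = z).card : ℝ) ≤ X.card / (2 * S) * √(s z) := by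
      intro z hz
      by_cases hzs : (X.card : ℝ) ≤ 2 * S * √(s z)
      · have : Y.filter (fun x => G x = z) = ∅ := by
          refine Finset.filter_eq_empty_iff.2 fun x hx hxz => ?_
          have := (Finset.mem_filter.1 hx).2
          rw [hxz] at this
          exact this hzs
        rw [this]
        simp only [Finset.card_empty, Nat.cast_zero]
        positivity
      · have h1 : ((Y.filter fun x => G x = z).card : ℝ) ≤ s z := by
          rw [hsdef]
          refine Nat.cast_le.2 (Finset.card_le_card ?_)
          exact Finset.filter_subset_filter _ (Finset.filter_subset _ _)
        have h2 : √(s z) ≤ X.card / (2 * S) := by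
          rw [le_div_iff₀ (by positivity)]
          linarith
        calc _ ≤ s z := h1
          _ = √(s z) * √(s z) := (Real.mul_self_sqrt (by linarith [hs0 z hz])).symm
          _ ≤ _ := by gcongr
    calc (Y.card : ℝ) = ∑ z ∈ Z, ((Y.filter fun x => G x = z).card : ℝ) := by
          rw [Finset.card_eq_sum_card_fiberwise (f := G) (t := Z)
            (fun x hx => Finset.mem_image_of_mem _ (Finset.mem_filter.1 hx).1)]
          push_cast
          rfl
      _ ≤ ∑ z ∈ Z, X.card / (2 * S) * √(s z) := Finset.sum_le_sum hYZ
      _ = X.card / (2 * S) * S := by rw [← Finset.mul_sum]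
      _ = X.card / 2 := by field_simp
  refine ⟨X', Finset.filter_subset _ _, ?_, ?_⟩
  · have h := Finset.card_filter_add_card_filter_not (s := X)
      (fun x => (X.card : ℝ) ≤ 2 * S * √(s (G x)))
    have h' : (X'.card : ℝ) + ((X.filter fun x => ¬ (X.card : ℝ) ≤ 2 * S * √(s (G x))).card : ℝ)
        = X.card := by exact_mod_cast h
    have : (X.card : ℝ) ≤ 2 * X'.card := by linarith
    exact_mod_cast this
  · have h1 : (X.card : ℝ) * (X'.image G).card ≤ ∑ z ∈ X'.image G, 2 * S * √(s z) := by
      rw [mul_comm, ← nsmul_eq_mul]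
      refine Finset.card_nsmul_le_sum _ _ _ fun z hz => ?_
      obtain ⟨x, hx, rfl⟩ := Finset.mem_image.1 hz
      exact (Finset.mem_filter.1 hx).2
    have h2 : ∑ z ∈ X'.image G, 2 * S * √(s z) ≤ 2 * S * S := by
      rw [← Finset.mul_sum]
      gcongr
      exact Finset.sum_le_sum_of_subset_of_nonneg
        (Finset.image_subset_image (Finset.filter_subset _ _)) fun _ _ _ => by positivity
    nlinarith

/-- If `x` is controlled by its two projections to `U` and `V`, the covering numbers of the
projections to `U`, `V` and `U ⊓ V` satisfy a submodularity inequality, after passing to a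
proportional subset. -/
lemma exists_subset_cov_mul_cov_inf_le (n : ℕ) : ∃ C : ℝ, 1 ≤ C ∧ ∀ (δ : ℝ), 0 < δ →
    ∀ (U V : Submodule ℝ (E n)) (K : ℝ), 1 ≤ K →
    (∀ x, ∀ η, ‖U.starProjection x‖ ≤ η → ‖V.starProjection x‖ ≤ η → ‖x‖ ≤ K * η) →
    ∀ A : Set (E n), Bornology.IsBounded A → ∃ A' ⊆ A, (cov δ A : ℝ) ≤ C * cov δ A' ∧
      (cov δ A : ℝ) * cov δ ((U ⊓ V).starProjection '' A') ≤
        C * K ^ n * (cov δ (U.starProjection '' A) * cov δ (V.starProjection '' A)) := by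
  classical
  set P : ℝ := (2 * n + 1 : ℝ) ^ n with hP
  have hP1 : 1 ≤ P := one_le_pow₀ (by linarith [(Nat.cast_nonneg n : (0 : ℝ) ≤ n)])
  set Q : ℝ := (2 * n + 3 : ℝ) ^ n with hQ
  have hQ1 : 1 ≤ Q := one_le_pow₀ (by linarith [(Nat.cast_nonneg n : (0 : ℝ) ≤ n)])
  refine ⟨2 * P ^ 4 * Q, ?_, ?_⟩
  · nlinarith [one_le_pow₀ hP1 (n := 4)]
  intro δ hδ U V K hK hUV A hA
  have hPcov : ∀ B : Set (E n), Bornology.IsBounded B → (cells δ B : ℝ) ≤ P * cov δ B := by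
    intro B hB
    have := cells_le_cov hδ hB
    rw [hP]
    exact_mod_cast this
  have hbdd : ∀ (W : Submodule ℝ (E n)) (B : Set (E n)), Bornology.IsBounded B →
      Bornology.IsBounded (W.starProjection '' B) := fun W B hB =>
    W.starProjection.lipschitz.isBounded_image hB
  obtain ⟨S, hSA, hS⟩ := (Set.surjOn_image (cell δ) A).exists_bijOn_subset
  have hSfin : S.Finite := by
    refine Set.Finite.of_finite_image ?_ hS.injOn
    rw [hS.image_eq]
    exact finite_cell_image hδ hA
  set X := hSfin.toFinset with hX
  have hXA : ∀ x ∈ X, x ∈ A := fun x hx => hSA (by simpa [hX] using hx)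
  have hXinj : Set.InjOn (cell δ) (X : Set (E n)) := by simpa [hX] using hS.injOn
  have hcardA : (X.card : ℝ) = cells δ A := by
    rw [cells, ← hS.image_eq, hS.injOn.ncard_image, Set.ncard_eq_toFinset_card S hSfin]
  set pu : E n → Fin n → ℤ := fun x => cell δ (U.starProjection x)
  set pv : E n → Fin n → ℤ := fun x => cell δ (V.starProjection x)
  set pg : E n → Fin n → ℤ := fun x => cell δ ((U ⊓ V).starProjection x)
  -- Points whose projections to a larger subspace share a cell have few cells downstairs.
  have hfew : ∀ W : Submodule ℝ (E n), U ⊓ V ≤ W →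
      ((X.image fun x => (cell δ (W.starProjection x), pg x)).card : ℝ) ≤
        P * (X.image fun x => cell δ (W.starProjection x)).card := by
    intro W hW
    have h := Finset.card_le_mul_card_image (f := Prod.fst)
      (X.image fun x => (cell δ (W.starProjection x), pg x)) ((2 * n + 1) ^ n) ?_
    · rw [Finset.image_image] at h
      have h' : (X.image fun x => (cell δ (W.starProjection x), pg x)).card ≤
        (2 * n + 1) ^ n * (X.image fun x => cell δ (W.starProjection x)).card := h
      rw [hP]
      exact_mod_cast h'
    · intro b hb
      simp only [Finset.mem_image, Prod.exists, exists_and_right, exists_eq_right] at hb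
      obtain ⟨c, x₀, hx₀, heq⟩ := hb
      have hb' : cell δ (W.starProjection x₀) = b := congrArg Prod.fst heq
      rw [← ncard_Icc_cell (pg x₀) n, ← Set.ncard_coe_finset,
        ← Set.InjOn.ncard_image (f := Prod.snd)]
      · refine Set.ncard_le_ncard ?_ (Set.finite_Icc _ _)
        rintro _ ⟨⟨a, d⟩, had, rfl⟩
        simp only [Finset.coe_filter, Finset.mem_image, Set.mem_ofPred_eq, Prod.mk.injEq] at had
        obtain ⟨⟨x, hx, rfl, rfl⟩, hab⟩ := had
        refine cell_mem_Icc hδ (R := δ) ?_ (by rw [mul_div_assoc, div_self hδ.ne', mul_one])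
        rw [← map_sub]
        have hcomp : (U ⊓ V).starProjection (x - x₀) =
            (U ⊓ V).starProjection (W.starProjection (x - x₀)) :=
          (congrArg (fun f => f (x - x₀)) (Submodule.starProjection_comp_starProjection_of_le hW)).symm
        rw [hcomp]
        refine ((U ⊓ V).norm_starProjection_apply_le _).trans ?_
        rw [map_sub, ← dist_eq_norm]
        exact dist_le_of_cell_eq hδ (hab.trans hb'.symm)
      · rintro ⟨a, d⟩ had ⟨a', d'⟩ had' hdd
        simp only [Finset.coe_filter, Set.mem_ofPred_eq] at had had'
        simp only at hdd
        rw [had.2, had'.2, hdd]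
  obtain ⟨X', hX'X, hX'card, hX'⟩ := exists_subset_card_mul_card_image_le X
    (fun x => (pu x, pg x)) (fun x => (pv x, pg x)) pg
    (fun x _ y _ h => congrArg Prod.snd h) (fun x _ y _ h => congrArg Prod.snd h)
    ((2 * ⌈n * K⌉₊ + 1) ^ n) (by
      rintro ⟨a, c⟩ ⟨b, c'⟩
      rcases (X.filter fun x => (pu x, pg x) = (a, c) ∧ (pv x, pg x) = (b, c')).eq_empty_or_nonempty
        with h | ⟨x₀, hx₀⟩
      · rw [h]; simp
      simp only [Finset.mem_filter, Prod.mk.injEq] at hx₀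
      rw [← ncard_Icc_cell (cell δ x₀), ← Set.ncard_coe_finset,
        ← Set.InjOn.ncard_image (f := cell δ)]
      · refine Set.ncard_le_ncard ?_ (Set.finite_Icc _ _)
        rintro _ ⟨x, hx, rfl⟩
        simp only [Finset.coe_filter, Prod.mk.injEq, Set.mem_ofPred_eq] at hx
        refine cell_mem_Icc hδ (R := K * δ) ?_ ?_
        · refine hUV _ _ ?_ ?_
          · rw [map_sub, ← dist_eq_norm]
            exact dist_le_of_cell_eq hδ (hx.2.1.1.trans hx₀.2.1.1.symm)
          · rw [map_sub, ← dist_eq_norm]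
            exact dist_le_of_cell_eq hδ (hx.2.2.1.trans hx₀.2.2.1.symm)
        · rw [← mul_assoc, mul_div_assoc, div_self hδ.ne', mul_one]
          exact Nat.le_ceil _
      · exact hXinj.mono fun x hx => by
          simp only [Finset.coe_filter, Set.mem_ofPred_eq] at hx
          exact hx.1)
  have hX'A : (X' : Set (E n)) ⊆ A := fun x hx => hXA x (hX'X hx)
  have hX'bd : Bornology.IsBounded (X' : Set (E n)) := hA.subset hX'A
  refine ⟨X', hX'A, ?_, ?_⟩
  · have h1 : (cov δ A : ℝ) ≤ X.card := by
      rw [hcardA]; exact_mod_cast cov_le_cells hδ hA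
    have h2 : (X'.card : ℝ) = cells δ (X' : Set (E n)) := by
      rw [cells, (hXinj.mono (by exact_mod_cast hX'X)).ncard_image, Set.ncard_coe_finset]
    have h3 : (X.card : ℝ) ≤ 2 * X'.card := by exact_mod_cast hX'card
    have h4 := hPcov _ hX'bd
    calc (cov δ A : ℝ) ≤ 2 * (P * cov δ (X' : Set (E n))) := by linarith
      _ = 2 * P * 1 * cov δ (X' : Set (E n)) := by ring
      _ ≤ 2 * P ^ 4 * Q * cov δ (X' : Set (E n)) := by
        gcongr
        exact le_self_pow₀ hP1 (by norm_num)
  · have hcellsW : ∀ (W : Submodule ℝ (E n)),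
        ((X.image fun x => cell δ (W.starProjection x)).card : ℝ) ≤
          P * cov δ (W.starProjection '' A) := by
      intro W
      refine le_trans ?_ (hPcov _ (hbdd W A hA))
      rw [cells, ← Set.ncard_coe_finset]
      refine Nat.cast_le.2 (Set.ncard_le_ncard ?_ (finite_cell_image hδ (hbdd W A hA)))
      intro y hy
      simp only [Finset.coe_image, Set.mem_image, Finset.mem_coe] at hy
      obtain ⟨x, hx, rfl⟩ := hy
      exact ⟨_, ⟨x, hXA x hx, rfl⟩, rfl⟩
    have h1 : (cov δ ((U ⊓ V).starProjection '' (X' : Set (E n))) : ℝ) ≤ (X'.image pg).card := by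
      refine Nat.cast_le.2 ((cov_le_cells hδ (hbdd _ _ hX'bd)).trans (le_of_eq ?_))
      rw [cells, ← Set.ncard_coe_finset, Finset.coe_image, Set.image_image]
    have h2 : (cov δ A : ℝ) ≤ X.card := by
      rw [hcardA]; exact_mod_cast cov_le_cells hδ hA
    have hD : (((2 * ⌈n * K⌉₊ + 1) ^ n : ℕ) : ℝ) ≤ Q * K ^ n := by
      rw [hQ, ← mul_pow]
      push_cast
      refine pow_le_pow_left₀ (by positivity) ?_ n
      have := (Nat.ceil_lt_add_one (show 0 ≤ n * K by positivity)).le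
      nlinarith
    have h3 := (hfew U inf_le_left).trans (mul_le_mul_of_nonneg_left (hcellsW U) (by positivity))
    have h4 := (hfew V inf_le_right).trans (mul_le_mul_of_nonneg_left (hcellsW V) (by positivity))
    calc _ ≤ (X.card : ℝ) * (X'.image pg).card := by gcongr
      _ ≤ _ := hX'
      _ ≤ 2 * (Q * K ^ n) * (P * (P * cov δ (U.starProjection '' A))) *
          (P * (P * cov δ (V.starProjection '' A))) := by gcongr
      _ = _ := by ring

/-! ### Quantitative transversality of subspaces -/

section

/-- Quantitative transversality: `‖v + w‖ ≥ c ‖v‖` for all `v ∈ V` and `w ∈ W`, that is, every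
vector of `V` makes an angle of sine at least `c` with `W`. For complementary dimensions this is
polynomially equivalent to a lower bound on `dang`, and it is easier to propagate through
intersections. -/
def Transversal {n : ℕ} (c : ℝ) (V W : Submodule ℝ (E n)) : Prop :=
  ∀ v ∈ V, ∀ w ∈ W, c * ‖v‖ ≤ ‖v + w‖

variable {n m : ℕ}

lemma Gr.le (V : Gr n m) : m ≤ n := by
  have h1 := Submodule.finrank_le V.1
  rw [V.2] at h1
  simpa using h1

lemma exists_equiv_sum_colMatrix (hm : m ≤ n) : ∃ e : Fin n ≃ Fin m ⊕ Fin (n - m),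
    ∀ (x : Fin m → E n) (y : Fin (n - m) → E n) (i j), colMatrix x y i j = Sum.elim x y (e j) i := by
  refine ⟨(finCongr (by omega : n = m + (n - m))).trans finSumFinEquiv.symm, fun x y i j => ?_⟩
  set e : Fin n ≃ Fin m ⊕ Fin (n - m) :=
    (finCongr (by omega : n = m + (n - m))).trans finSumFinEquiv.symm with he
  by_cases h : (j : ℕ) < m
  · have : e j = Sum.inl ⟨j, h⟩ := by
      rw [← Equiv.eq_symm_apply]; ext; simp [e]
    simp [colMatrix, h, this]
  · have : e j = Sum.inr ⟨(j : ℕ) - m, by omega⟩ := by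
      rw [← Equiv.eq_symm_apply]; ext; simp [e]; omega
    simp [colMatrix, h, this]

lemma coe_eq_sum_repr_smul {V : Submodule ℝ (E n)} (b : OrthonormalBasis (Fin m) ℝ V) (v : V) :
    (v : E n) = ∑ a, b.repr v a • (b a : E n) := by
  conv_lhs => rw [← b.sum_repr v]
  simp

lemma colMatrix_mulVec {e : Fin n ≃ Fin m ⊕ Fin (n - m)} {x : Fin m → E n}
    {y : Fin (n - m) → E n} (he : ∀ i j, colMatrix x y i j = Sum.elim x y (e j) i)
    (z : Fin n → ℝ) :
    colMatrix x y *ᵥ z =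
      (∑ a, z (e.symm (Sum.inl a)) • x a + ∑ b, z (e.symm (Sum.inr b)) • y b : E n) := by
  ext i
  simp only [Matrix.mulVec, dotProduct, he, PiLp.add_apply, WithLp.ofLp_sum, Finset.sum_apply,
    PiLp.smul_apply, smul_eq_mul]
  rw [← e.symm.sum_comp, Fintype.sum_sum_type]
  simp [mul_comm]

lemma abs_apply_le_norm (x : E n) (i : Fin n) : |x i| ≤ ‖x‖ := by
  simpa using PiLp.norm_apply_le x i

lemma Gr.norm_onb (V : Gr n m) (a : Fin m) : ‖(V.onb a : E n)‖ = 1 := V.onb.norm_eq_one a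

lemma abs_colMatrix_le_one (V : Gr n m) (W : Gr n (n - m)) (i j : Fin n) :
    |colMatrix (fun a => (V.onb a : E n)) (fun b => (W.onb b : E n)) i j| ≤ 1 := by
  simp only [colMatrix, Matrix.of_apply]
  split_ifs with h
  · exact (abs_apply_le_norm _ _).trans (V.norm_onb _).le
  · exact (abs_apply_le_norm _ _).trans (W.norm_onb _).le

/-- The upper bound follows from Cramer's rule, the cofactors being bounded. -/
lemma exists_dang_le_of_not_transversal (n : ℕ) : ∃ C : ℝ, 1 ≤ C ∧ ∀ (m : ℕ) (V : Gr n m)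
    (W : Gr n (n - m)) (c : ℝ), ¬ Transversal c V.1 W.1 → dang V W ≤ C * c := by
  refine ⟨n * (n * (n.factorial : ℝ)) + 1, le_add_of_nonneg_left (by positivity), fun m V W c hc => ?_⟩
  simp only [Transversal, not_forall, not_le] at hc
  obtain ⟨v, hv, w, hw, hlt⟩ := hc
  have hcv : 0 < c * ‖v‖ := (norm_nonneg _).trans_lt hlt
  have hvpos : 0 < ‖v‖ := by
    rcases (norm_nonneg v).eq_or_lt with h | h
    · rw [← h, mul_zero] at hcv; exact absurd hcv (lt_irrefl _)
    · exact h
  have hcpos : 0 < c := pos_of_mul_pos_left hcv hvpos.le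
  obtain ⟨e, he⟩ := exists_equiv_sum_colMatrix V.le
  set M := colMatrix (fun a => (V.onb a : E n)) (fun b => (W.onb b : E n)) with hM
  set x := fun a => V.onb.repr ⟨v, hv⟩ a with hx
  set y := fun b => W.onb.repr ⟨w, hw⟩ b with hy
  set z : Fin n → ℝ := fun j => Sum.elim x y (e j) with hz
  have hvx : v = ∑ a, x a • (V.onb a : E n) := coe_eq_sum_repr_smul V.onb ⟨v, hv⟩
  have hwy : w = ∑ b, y b • (W.onb b : E n) := coe_eq_sum_repr_smul W.onb ⟨w, hw⟩
  have hMz : M *ᵥ z = (v + w : E n) := by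
    rw [hM, colMatrix_mulVec (he _ _)]
    congr 1
    simp only [hz, Equiv.apply_symm_apply, Sum.elim_inl, Sum.elim_inr]
    exact (congrArg₂ _ hvx hwy).symm
  have hadj : ∀ i j, |M.adjugate i j| ≤ n.factorial := by
    intro i j
    rw [Matrix.adjugate_apply]
    have := Matrix.det_le (A := M.updateRow j (Pi.single i 1)) (abv := AbsoluteValue.abs) (x := 1)
      (fun k l => by
        simp only [AbsoluteValue.abs_apply, Matrix.updateRow_apply]
        split_ifs with hk
        · by_cases hl : l = i
          · simp [hl]
          · simp [hl]
        · exact abs_colMatrix_le_one V W k l)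
    simpa using this
  have hdet : M.det • z = M.adjugate *ᵥ (M *ᵥ z) := by
    rw [Matrix.mulVec_mulVec, Matrix.adjugate_mul, Matrix.smul_mulVec, Matrix.one_mulVec]
  have hzj : ∀ j, |M.det| * |z j| ≤ n * (n.factorial * ‖v + w‖) := by
    intro j
    have h1 := congrFun hdet j
    simp only [Pi.smul_apply, smul_eq_mul] at h1
    rw [← abs_mul, h1, hMz]
    simp only [Matrix.mulVec, dotProduct]
    refine (Finset.abs_sum_le_sum_abs (fun i => M.adjugate j i * (v + w : E n) i) _).trans ?_
    have : ∀ i ∈ (Finset.univ : Finset (Fin n)), |M.adjugate j i * (v + w : E n) i| ≤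
        n.factorial * ‖v + w‖ := fun i _ => by
      rw [abs_mul]
      exact mul_le_mul (hadj j i) (abs_apply_le_norm _ _) (abs_nonneg _) (by positivity)
    simpa using Finset.sum_le_card_nsmul _ _ _ this
  have hnorm : ‖v‖ ≤ ∑ a, |x a| := by
    conv_lhs => rw [hvx]
    refine (norm_sum_le _ _).trans (Finset.sum_le_sum fun a _ => ?_)
    rw [norm_smul, V.norm_onb, mul_one,
      Real.norm_eq_abs]
  have hfin : |M.det| * ‖v‖ ≤ n * (n * (n.factorial * ‖v + w‖)) := by
    calc |M.det| * ‖v‖ ≤ |M.det| * ∑ a, |x a| := by gcongr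
      _ = ∑ a, |M.det| * |z (e.symm (Sum.inl a))| := by simp [Finset.mul_sum, hz]
      _ ≤ ∑ _a : Fin m, (n : ℝ) * (n.factorial * ‖v + w‖) :=
        Finset.sum_le_sum fun a _ => hzj _
      _ = m * (n * (n.factorial * ‖v + w‖)) := by simp
      _ ≤ _ := by
        have : (m : ℝ) ≤ n := by exact_mod_cast V.le
        gcongr
  have h2 : |M.det| * ‖v‖ ≤ (n * (n * (n.factorial : ℝ)) * c) * ‖v‖ := by
    refine hfin.trans ?_
    calc (n : ℝ) * (n * (n.factorial * ‖v + w‖)) ≤ n * (n * (n.factorial * (c * ‖v‖))) := by gcongr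
      _ = _ := by ring
  have h3 : dang V W ≤ n * (n * (n.factorial : ℝ)) * c := le_of_mul_le_mul_right h2 hvpos
  nlinarith

/-- The lower bound follows by bounding the entries of the inverse matrix. -/
lemma exists_pow_le_dang_of_transversal (n : ℕ) : ∃ C : ℝ, 1 ≤ C ∧ ∀ (m : ℕ) (V : Gr n m)
    (W : Gr n (n - m)) (c : ℝ), 0 < c → c ≤ 1 → Transversal c V.1 W.1 → c ^ n ≤ C * dang V W := by
  refine ⟨n.factorial * 2 ^ n, one_le_mul_of_one_le_of_one_le (by exact_mod_cast n.factorial_pos)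
    (one_le_pow₀ (by norm_num)), fun m V W c hc hc1 hVW => ?_⟩
  obtain ⟨e, he⟩ := exists_equiv_sum_colMatrix V.le
  set M := colMatrix (fun a => (V.onb a : E n)) (fun b => (W.onb b : E n)) with hM
  have hbound : ∀ (z : Fin n → ℝ) (u : E n), M *ᵥ z = u → ∀ j, |z j| ≤ 2 / c * ‖u‖ := by
    intro z u hzu j
    rw [hM, colMatrix_mulVec (he _ _)] at hzu
    set v : V.1 := ∑ a, z (e.symm (Sum.inl a)) • V.onb a with hv
    set w : W.1 := ∑ b, z (e.symm (Sum.inr b)) • W.onb b with hw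
    have hu : u = (v : E n) + w := by
      rw [hv, hw]
      push_cast
      exact (WithLp.ofLp_injective 2 hzu).symm
    have h1 : c * ‖v‖ ≤ ‖u‖ := by rw [hu]; exact hVW v v.2 w w.2
    have h2 : ‖v‖ ≤ ‖u‖ / c := by rw [le_div_iff₀ hc]; linarith
    have h3 : ‖u‖ ≤ ‖u‖ / c := le_div_self (norm_nonneg _) hc hc1
    have h4 : ‖w‖ ≤ ‖u‖ + ‖v‖ := by
      have : (w : E n) = u - v := by rw [hu]; abel
      calc ‖w‖ = ‖(w : E n)‖ := rfl
        _ ≤ ‖u‖ + ‖(v : E n)‖ := by rw [this]; exact norm_sub_le _ _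
        _ = _ := rfl
    have h5 : 2 / c * ‖u‖ = ‖u‖ / c + ‖u‖ / c := by ring
    have hcoord : ∀ {k : ℕ} (U : Submodule ℝ (E n)) (b : OrthonormalBasis (Fin k) ℝ U)
        (t : Fin k → ℝ) (a : Fin k), |t a| ≤ ‖∑ i, t i • b i‖ := by
      intro k U b t a
      have h6 : inner ℝ (b a) (∑ i, t i • b i) = t a := b.orthonormal.inner_right_fintype t a
      calc |t a| = |inner ℝ (b a) (∑ i, t i • b i)| := by rw [h6]
        _ ≤ ‖b a‖ * ‖∑ i, t i • b i‖ := abs_real_inner_le_norm _ _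
        _ = _ := by rw [b.norm_eq_one, one_mul]
    rw [h5]
    obtain ⟨s, rfl⟩ := e.symm.surjective j
    rcases s with a | b
    · exact (hcoord V.1 V.onb (fun a => z (e.symm (Sum.inl a))) a).trans (by
        rw [← hv]; linarith [norm_nonneg u])
    · exact (hcoord W.1 W.onb (fun b => z (e.symm (Sum.inr b))) b).trans (by
        rw [← hw]; linarith)
  have hunit : IsUnit M := by
    rw [← Matrix.mulVec_injective_iff_isUnit]
    intro z z' hzz'
    have h1 : M *ᵥ (z - z') = (0 : E n) := by
      rw [Matrix.mulVec_sub, sub_eq_zero.2 hzz']; rfl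
    funext j
    have := hbound _ _ h1 j
    rw [norm_zero, mul_zero] at this
    exact sub_eq_zero.1 (abs_nonpos_iff.1 this)
  have hinv : ∀ i j, |M⁻¹ i j| ≤ 2 / c := by
    intro i j
    have h1 : M *ᵥ (M⁻¹ *ᵥ Pi.single j 1) = (EuclideanSpace.single j (1 : ℝ) : E n) := by
      rw [Matrix.mulVec_mulVec, Matrix.mul_nonsing_inv _ ((Matrix.isUnit_iff_isUnit_det _).1 hunit),
        Matrix.one_mulVec]
      simp
    have := hbound _ _ h1 i
    simpa using this
  have hdetinv : |M⁻¹.det| ≤ n.factorial * (2 / c) ^ n := by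
    have := Matrix.det_le (A := M⁻¹) (abv := AbsoluteValue.abs) (x := 2 / c) hinv
    simpa using this
  have hprod : |M.det| * |M⁻¹.det| = 1 := by
    rw [← abs_mul, ← Matrix.det_mul, Matrix.mul_nonsing_inv _
      ((Matrix.isUnit_iff_isUnit_det _).1 hunit), Matrix.det_one, abs_one]
  have h1 : 1 ≤ |M.det| * (n.factorial * (2 / c) ^ n) := by
    rw [← hprod]; gcongr
  have hcn : 0 < c ^ n := by positivity
  rw [div_pow, ← mul_div_assoc, ← mul_div_assoc, le_div_iff₀ hcn, one_mul] at h1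
  calc c ^ n ≤ _ := h1
    _ = _ := by rw [dang]; ring

lemma Transversal.disjoint {c : ℝ} (hc : 0 < c) {V W : Submodule ℝ (E n)}
    (h : Transversal c V W) : Disjoint V W := by
  rw [Submodule.disjoint_def]
  intro x hxV hxW
  have := h x hxV (-x) (W.neg_mem hxW)
  rw [add_neg_cancel, norm_zero] at this
  exact norm_le_zero_iff.1 (by nlinarith [norm_nonneg x])

lemma Transversal.sup_eq_top {c : ℝ} (hc : 0 < c) {V W : Submodule ℝ (E n)}
    (h : Transversal c V W) (hdim : Module.finrank ℝ V + Module.finrank ℝ W = n) : V ⊔ W = ⊤ :=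
  Submodule.eq_top_of_disjoint V W (by simp [hdim]) (h.disjoint hc)

/-- Here `U ⊓ W` is a complement of `W'` in `W`, because `U` is one in the whole space. -/
lemma Transversal.finrank_inf {c : ℝ} (hc : 0 < c) {U W W' : Submodule ℝ (E n)} (hW : W' ≤ W)
    (h : Transversal c U W') (hdim : Module.finrank ℝ U + Module.finrank ℝ W' = n) :
    Module.finrank ℝ (U ⊓ W : Submodule ℝ (E n)) + Module.finrank ℝ W' = Module.finrank ℝ W := by
  have h1 : W' ⊔ U ⊓ W = W := by
    rw [← sup_inf_assoc_of_le U hW, sup_comm, h.sup_eq_top hc hdim, top_inf_eq]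
  have h2 : W' ⊓ (U ⊓ W) = ⊥ :=
    eq_bot_iff.2 fun x hx => (h.disjoint hc).le_bot ⟨hx.2.1, hx.1⟩
  have h3 := Submodule.finrank_sup_add_finrank_inf_eq W' (U ⊓ W)
  rw [h1, h2, finrank_bot] at h3
  omega

/-- Transversality of an intersection: it suffices that `U` is transverse to part of `W`, and `V`
to what remains of `W` inside `U`. -/
lemma Transversal.inf {c₁ c₂ : ℝ} (hc₁ : 0 < c₁) {U V W W' : Submodule ℝ (E n)}
    (hW : W' ≤ W) (hU : Transversal c₁ U W') (hV : Transversal c₂ V (U ⊓ W))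
    (hdim : Module.finrank ℝ U + Module.finrank ℝ W' = n) :
    Transversal (c₁ * c₂) (U ⊓ V) W := by
  intro x hx w hw
  have hwtop : w ∈ U ⊔ W' := by rw [hU.sup_eq_top hc₁ hdim]; trivial
  obtain ⟨u, hu, w', hw', rfl⟩ := Submodule.mem_sup.1 hwtop
  have huW : u ∈ W := by
    have := W.sub_mem hw (hW hw')
    rwa [add_sub_cancel_right] at this
  have h1 := hU (x + u) (U.add_mem hx.1 hu) w' hw'
  have h2 := hV x hx.2 u ⟨hu, huW⟩
  rw [add_assoc] at h1
  calc c₁ * c₂ * ‖x‖ = c₁ * (c₂ * ‖x‖) := by ring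
    _ ≤ c₁ * ‖x + u‖ := by gcongr
    _ ≤ _ := h1

lemma Transversal.norm_le_of_starProjection_le {c : ℝ} (hc : 0 < c) (hc1 : c ≤ 1)
    {U V Y : Submodule ℝ (E n)} (h : Transversal c V Y) (hYU : Y ≤ U)
    (hdim : Module.finrank ℝ V + Module.finrank ℝ Y = n) (x : E n) (η : ℝ)
    (hU : ‖U.starProjection x‖ ≤ η) (hV : ‖V.starProjection x‖ ≤ η) : ‖x‖ ≤ 3 / c * η := by
  have hη : 0 ≤ η := (norm_nonneg _).trans hU
  have hxtop : x ∈ V ⊔ Y := by rw [h.sup_eq_top hc hdim]; trivial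
  obtain ⟨v, hv, u, hu, rfl⟩ := Submodule.mem_sup.1 hxtop
  have h1 : ‖v‖ ≤ ‖v + u‖ / c := by rw [le_div_iff₀ hc]; linarith [h v hv u hu]
  have h2 : ‖u‖ ≤ ‖v + u‖ + ‖v‖ := by
    have : u = (v + u) - v := by abel
    conv_lhs => rw [this]
    exact norm_sub_le _ _
  have h3 : ‖v + u‖ ≤ ‖v + u‖ / c := le_div_self (norm_nonneg _) hc hc1
  have key : ∀ (W : Submodule ℝ (E n)) (w : E n), w ∈ W → ‖W.starProjection (v + u)‖ ≤ η →
      inner ℝ (v + u) w ≤ η * ‖w‖ := by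
    intro W w hw hle
    have h4 : inner ℝ (v + u) w = inner ℝ (W.starProjection (v + u)) w := by
      rw [Submodule.inner_starProjection_left_eq_right, Submodule.starProjection_eq_self_iff.2 hw]
    rw [h4]
    exact (real_inner_le_norm _ _).trans (by gcongr)
  have h5 : ‖v + u‖ * ‖v + u‖ ≤ η * ‖v‖ + η * ‖u‖ := by
    rw [← real_inner_self_eq_norm_mul_norm]
    conv_lhs => rw [inner_add_right]
    exact add_le_add (key V v hv hV) (key U u (hYU hu) hU)
  rcases (norm_nonneg (v + u)).eq_or_lt with h6 | h6
  · rw [← h6]; positivity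
  refine le_of_mul_le_mul_right (h5.trans ?_) h6
  calc η * ‖v‖ + η * ‖u‖ ≤ η * (‖v + u‖ / c) + η * (‖v + u‖ / c + ‖v + u‖ / c) := by
        gcongr; linarith
    _ = _ := by ring

lemma exists_submodule_le_finrank_eq (W : Submodule ℝ (E n)) {k : ℕ}
    (hk : k ≤ Module.finrank ℝ W) : ∃ W' ≤ W, Module.finrank ℝ W' = k := by
  have b := Module.finBasis ℝ W
  have hli : LinearIndependent ℝ fun i : Fin k => (b (Fin.castLE hk i) : E n) :=
    (b.linearIndependent.comp _ (Fin.castLE_injective hk)).map' W.subtype W.ker_subtype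
  refine ⟨Submodule.span ℝ (Set.range fun i : Fin k => (b (Fin.castLE hk i) : E n)), ?_, ?_⟩
  · rw [Submodule.span_le]
    rintro _ ⟨i, rfl⟩
    exact (b _).2
  · rw [finrank_span_eq_card hli, Fintype.card_fin]

end

/-! ### Measurability of intersections of subspaces -/

section Measurability

variable {n m a b : ℕ} {X : Type*} [MeasurableSpace X]

lemma Gr.continuous_proj : Continuous (Gr.proj : Gr n m → E n →L[ℝ] E n) :=
  continuous_induced_dom

lemma Gr.measurable_of_measurable_proj {f : X → Gr n m} (hf : Measurable fun x => (f x).proj) :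
    Measurable f := by
  intro s hs
  have hs' : MeasurableSet[(borel (E n →L[ℝ] E n)).comap Gr.proj] s := by
    rw [← borel_comap]
    exact hs
  obtain ⟨t, ht, rfl⟩ := hs'
  have ht' : MeasurableSet t := by
    rw [BorelSpace.measurable_eq (α := E n →L[ℝ] E n)]
    exact ht
  exact hf ht'

lemma measurable_clm_of_apply {F : X → E n →L[ℝ] E n} (hF : ∀ x, Measurable fun p => F p x) :
    Measurable F := by
  have h : F = fun p => ∑ i, (innerSL ℝ (EuclideanSpace.basisFun (Fin n) ℝ i)).smulRight
      (F p (EuclideanSpace.basisFun (Fin n) ℝ i)) := by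
    funext p
    ext1 x
    conv_lhs => rw [← (EuclideanSpace.basisFun (Fin n) ℝ).sum_repr' x]
    simp
  rw [h]
  refine Finset.measurable_sum _ fun i _ => ?_
  have hc : Continuous fun y : E n =>
      (innerSL ℝ (EuclideanSpace.basisFun (Fin n) ℝ i)).smulRight y :=
    (ContinuousLinearMap.smulRightL ℝ (E n) (E n)
      (innerSL ℝ (EuclideanSpace.basisFun (Fin n) ℝ i))).continuous
  exact hc.measurable.comp (hF _)

lemma eqLocus_average_starProjection (U V : Submodule ℝ (E n)) :
    ((1 / 2 : ℝ) • (U.starProjection + V.starProjection)).eqLocus (1 : E n →L[ℝ] E n) = U ⊓ V := by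
  ext x
  constructor
  · intro hx
    have hx' : (1 / 2 : ℝ) • (U.starProjection x + V.starProjection x) = x := hx
    have hU := U.norm_starProjection_apply_le x
    have hV := V.norm_starProjection_apply_le x
    have h1 : ‖x‖ ≤ 1 / 2 * (‖U.starProjection x‖ + ‖V.starProjection x‖) := by
      conv_lhs => rw [← hx', norm_smul]
      rw [Real.norm_of_nonneg (by norm_num)]
      gcongr
      exact norm_add_le _ _
    exact ⟨(U.mem_iff_norm_starProjection x).2 (by linarith),
      (V.mem_iff_norm_starProjection x).2 (by linarith)⟩
  · rintro ⟨hU, hV⟩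
    change (1 / 2 : ℝ) • (U.starProjection x + V.starProjection x) = x
    rw [Submodule.starProjection_eq_self_iff.2 hU, Submodule.starProjection_eq_self_iff.2 hV,
      ← two_smul ℝ, smul_smul]
    norm_num

/-- By von Neumann's mean ergodic theorem, the projection to `U ⊓ V` is the limit of the ergodic
averages of the contraction `(π_U + π_V) / 2`, which depend continuously on `(π_U, π_V)`. -/
lemma measurable_starProjection_inf :
    Measurable fun p : Gr n a × Gr n m => (p.1.1 ⊓ p.2.1).starProjection := by
  refine measurable_clm_of_apply fun x => ?_
  let f : (E n →L[ℝ] E n) × (E n →L[ℝ] E n) → E n →L[ℝ] E n := fun q => (1 / 2 : ℝ) • (q.1 + q.2)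
  have hcont : ∀ k : ℕ, Continuous fun q => (f q)^[k] x := by
    intro k
    induction k with
    | zero => simpa using continuous_const
    | succ k ih =>
      simp only [Function.iterate_succ_apply']
      have : Continuous f := by fun_prop
      exact this.clm_apply ih
  have hproj : Measurable fun p : Gr n a × Gr n m => (p.1.proj, p.2.proj) :=
    (Gr.continuous_proj.measurable.comp measurable_fst).prodMk
      (Gr.continuous_proj.measurable.comp measurable_snd)
  refine measurable_of_tendsto_metrizable
    (f := fun (N : ℕ) (p : Gr n a × Gr n m) =>
      birkhoffAverage ℝ (f (p.1.proj, p.2.proj)) _root_.id N x) (fun N => ?_) ?_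
  · have : Continuous fun q => birkhoffAverage ℝ (f q) _root_.id N x := by
      simp only [birkhoffAverage, birkhoffSum, id]
      exact (continuous_finsetSum _ fun k _ => hcont k).const_smul ((N : ℝ)⁻¹)
    exact this.measurable.comp hproj
  · rw [tendsto_pi_nhds]
    rintro ⟨U, V⟩
    have hnorm : ‖f (U.proj, V.proj)‖ ≤ 1 := by
      have h1 : ‖U.proj‖ ≤ 1 := U.1.starProjection_norm_le
      have h2 : ‖V.proj‖ ≤ 1 := V.1.starProjection_norm_le
      change ‖(1 / 2 : ℝ) • (U.proj + V.proj)‖ ≤ 1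
      rw [norm_smul, Real.norm_of_nonneg (by norm_num)]
      linarith [norm_add_le U.proj V.proj]
    have h := (f (U.proj, V.proj)).tendsto_birkhoffAverage_orthogonalProjection hnorm x
    have hloc : (f (U.proj, V.proj)).eqLocus (1 : E n →L[ℝ] E n) = U.1 ⊓ V.1 :=
      eqLocus_average_starProjection U.1 V.1
    have key : ∀ W : Submodule ℝ (E n), W = U.1 ⊓ V.1 →
        (W.orthogonalProjectionOnto x : E n) = (U.1 ⊓ V.1).starProjection x := by
      rintro _ rfl
      rfl
    rw [key _ hloc] at h
    exact h

lemma finrank_eq_sum_inner_starProjection (W : Submodule ℝ (E n)) :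
    (Module.finrank ℝ W : ℝ) = ∑ i, inner ℝ (EuclideanSpace.basisFun (Fin n) ℝ i)
      (W.starProjection (EuclideanSpace.basisFun (Fin n) ℝ i)) := by
  have h : LinearMap.IsProj W (W.starProjection : E n →ₗ[ℝ] E n) :=
    ⟨fun x => W.starProjection_apply_mem x, fun x hx => Submodule.starProjection_eq_self_iff.2 hx⟩
  rw [← h.trace, LinearMap.trace_eq_sum_inner _ (EuclideanSpace.basisFun (Fin n) ℝ)]
  rfl

open Classical in
/-- The intersection of two subspaces as a point of `Gr(ℝⁿ, b)`; pairs whose intersection has a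
dimension other than `b` are sent to the base point `D`. -/
def Gr.inter (D : Gr n b) (p : Gr n a × Gr n m) : Gr n b :=
  if h : Module.finrank ℝ (p.1.1 ⊓ p.2.1 : Submodule ℝ (E n)) = b then ⟨p.1.1 ⊓ p.2.1, h⟩ else D

lemma Gr.inter_val {D : Gr n b} {U : Gr n a} {V : Gr n m}
    (h : Module.finrank ℝ (U.1 ⊓ V.1 : Submodule ℝ (E n)) = b) :
    (Gr.inter D (U, V)).1 = U.1 ⊓ V.1 :=
  congrArg Subtype.val (dif_pos h)

lemma Gr.measurable_inter (D : Gr n b) :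
    Measurable (Gr.inter D : Gr n a × Gr n m → Gr n b) := by
  classical
  refine Gr.measurable_of_measurable_proj ?_
  have hset : MeasurableSet {p : Gr n a × Gr n m |
      Module.finrank ℝ (p.1.1 ⊓ p.2.1 : Submodule ℝ (E n)) = b} := by
    have hm : Measurable fun p : Gr n a × Gr n m =>
        (Module.finrank ℝ (p.1.1 ⊓ p.2.1 : Submodule ℝ (E n)) : ℝ) := by
      simp only [finrank_eq_sum_inner_starProjection]
      exact Finset.measurable_sum _ fun i _ =>
        Measurable.const_inner (measurable_starProjection_inf.apply_continuousLinearMap _)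
    have := hm (measurableSet_singleton (b : ℝ))
    convert this using 1
    ext p
    simp
  have : (fun p : Gr n a × Gr n m => (Gr.inter D p).proj) = fun p =>
      if Module.finrank ℝ (p.1.1 ⊓ p.2.1 : Submodule ℝ (E n)) = b then
        (p.1.1 ⊓ p.2.1).starProjection else D.proj := by
    funext p
    by_cases h : Module.finrank ℝ (p.1.1 ⊓ p.2.1 : Submodule ℝ (E n)) = b
    · have h1 : Gr.inter D p = ⟨p.1.1 ⊓ p.2.1, h⟩ := dif_pos h
      rw [h1, if_pos h]
      rfl
    · have h1 : Gr.inter D p = D := dif_neg h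
      rw [h1, if_neg h]
  rw [this]
  exact Measurable.ite hset measurable_starProjection_inf measurable_const

lemma measurableSet_transversal (c : ℝ) (W : Submodule ℝ (E n)) :
    MeasurableSet {U : Gr n a | Transversal c U.1 W} := by
  have h : {U : Gr n a | Transversal c U.1 W} =
      ⋂ (x : E n) (w ∈ W), {U : Gr n a | c * ‖U.proj x‖ ≤ ‖U.proj x + w‖} := by
    ext U
    simp only [Set.mem_iInter]
    constructor
    · exact fun hU x w hw => hU _ (U.1.starProjection_apply_mem x) w hw
    · intro hU v hv w hw
      have h1 : U.proj v = v := Submodule.starProjection_eq_self_iff.2 hv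
      have h2 : c * ‖U.proj v‖ ≤ ‖U.proj v + w‖ := hU v w hw
      rwa [h1] at h2
  rw [h]
  refine IsClosed.measurableSet (isClosed_iInter fun x => isClosed_iInter fun w =>
    isClosed_iInter fun _ => ?_)
  have hx : Continuous fun U : Gr n a => U.proj x := Gr.continuous_proj.clm_apply continuous_const
  exact isClosed_le (continuous_const.mul hx.norm) (hx.add continuous_const).norm

end Measurability

/-! ### Fibrewise estimates for product measures -/

section ProductMeasure

variable {α β γ : Type*} [MeasurableSpace α] [MeasurableSpace β] [MeasurableSpace γ]
  (ν : Measure α) (μ : Measure β) [IsProbabilityMeasure μ]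
  {f : α × β → γ} {B : Set γ}

lemma map_prod_le_add [IsProbabilityMeasure ν] (hf : Measurable f) (hB : MeasurableSet B)
    (S : Set α) {p : ℝ≥0∞}
    (h : ∀ x ∉ S, μ {y | f (x, y) ∈ B} ≤ p) : (ν.prod μ).map f B ≤ ν S + p := by
  rw [Measure.map_apply hf hB, Measure.prod_apply (hf hB)]
  calc ∫⁻ x, μ (Prod.mk x ⁻¹' (f ⁻¹' B)) ∂ν
      ≤ ∫⁻ x, (toMeasurable ν S).indicator 1 x + p ∂ν := by
        refine lintegral_mono fun x => ?_
        by_cases hx : x ∈ S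
        · rw [Set.indicator_of_mem (subset_toMeasurable ν S hx)]
          exact prob_le_one.trans le_self_add
        · exact (h x hx).trans le_add_self
    _ = ν S + p := by
        rw [lintegral_add_right _ measurable_const,
          lintegral_indicator_one (measurableSet_toMeasurable _ _), measure_toMeasurable,
          lintegral_const, measure_univ, mul_one]

/-- Neither `B` nor `G` needs to be measurable: all the measures are outer measures. -/
lemma mul_le_map_prod (hf : Measurable f) (G : Set α) {t : ℝ≥0∞}
    (h : ∀ x ∈ G, t ≤ μ {y | f (x, y) ∈ B}) : t * ν G ≤ (ν.prod μ).map f B := by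
  refine le_trans ?_ (Measure.le_map_apply hf.aemeasurable B)
  rw [← measure_toMeasurable (μ := ν.prod μ)]
  set T := toMeasurable (ν.prod μ) (f ⁻¹' B) with hT
  have hTm : MeasurableSet T := measurableSet_toMeasurable _ _
  rw [Measure.prod_apply hTm]
  refine le_trans ?_ (mul_meas_ge_le_lintegral (measurable_measure_prodMk_left hTm) t)
  gcongr
  intro x hx
  refine (h x hx).trans (measure_mono fun y hy => ?_)
  exact subset_toMeasurable _ _ hy

end ProductMeasure

/-! ### Large subsets with few exceptional directions -/

lemma eventually_le_rpow_neg (C : ℝ) {t : ℝ} (ht : 0 < t) :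
    ∀ᶠ δ : ℝ in 𝓝[>] 0, C ≤ δ ^ (-t) :=
  (tendsto_rpow_neg_nhdsGT_zero (neg_lt_zero.2 ht)).eventually_ge_atTop C

lemma eventually_pos_lt_one : ∀ᶠ δ : ℝ in 𝓝[>] 0, 0 < δ ∧ δ < 1 :=
  Ioo_mem_nhdsGT zero_lt_one

section

variable {n m r : ℕ} {δ : ℝ}

lemma isBounded_image_proj (V : Gr n m) {B : Set (E n)} (hB : Bornology.IsBounded B) :
    Bornology.IsBounded (V.proj '' B) :=
  V.proj.lipschitz.isBounded_image hB

lemma exceptional_empty (hδ : 0 < δ) (α ε : ℝ) :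
    exceptional n m α ε δ (∅ : Set (E n)) = Set.univ := by
  refine Set.eq_univ_of_forall fun V => ⟨∅, Set.Subset.rfl, ?_, ?_⟩
  · simp [cov]
  · simp only [Set.image_empty, cov, Metric.externalCoveringNumber_empty, ENat.toNat_zero,
      Nat.cast_zero]
    positivity

lemma exceptional_mono (hδ : 0 < δ) (hδ1 : δ < 1) {α ε ε' : ℝ} (h : ε ≤ ε') (A : Set (E n)) :
    exceptional n m α ε δ A ⊆ exceptional n m α ε' δ A := by
  rintro V ⟨A', hA', h1, h2⟩
  refine ⟨A', hA', le_trans ?_ h1, h2.trans_le ?_⟩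
  · gcongr ?_ * _
    exact Real.rpow_le_rpow_of_exponent_ge hδ hδ1.le h
  · exact Real.rpow_le_rpow_of_exponent_ge hδ hδ1.le (by linarith)

/-- `B ⊆ A` is *controlled* with respect to `ν` if some measurable `h`, with integral at most
`δ ^ ε` times the number of cells of `B`, bounds for every direction `V` the size of the subsets of
`B` with a small projection to `V`, up to an error `C δ ^ ε`. The sum of the indicators of the
exceptional sets of the pieces of `B`, weighted by the sizes of the pieces, is such an `h`; this
formulation passes to unions of pieces that share no cell. -/
def Controlled (α ε C δ : ℝ) (ν : Measure (Gr n r)) (B : Set (E n)) : Prop :=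
  ∃ h : Gr n r → ℝ≥0∞, Measurable h ∧
    ∫⁻ V, h V ∂ν ≤ ENNReal.ofReal (δ ^ ε) * (cells δ B : ℝ≥0∞) ∧
    ∀ V : Gr n r, ∀ B' ⊆ B, (cov δ (V.proj '' B') : ℝ) < δ ^ (-((r : ℝ) / n * α) - ε) →
      (cells δ B' : ℝ≥0∞) ≤ ENNReal.ofReal (C * δ ^ ε) * (cells δ B : ℝ≥0∞) + h V

lemma controlled_empty (α ε C : ℝ) (ν : Measure (Gr n r)) :
    Controlled α ε C δ ν (∅ : Set (E n)) := by
  refine ⟨fun _ => 0, measurable_const, by simp, fun V B' hB' _ => ?_⟩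
  rw [Set.subset_empty_iff.1 hB']
  simp [cells]

lemma Controlled.union (hδ : 0 < δ) {α ε : ℝ} {ν : Measure (Gr n r)} {B A₁ : Set (E n)}
    (hB : Controlled α ε ((2 * n + 1) ^ n) δ ν B) (hBb : Bornology.IsBounded B)
    (hAb : Bornology.IsBounded A₁) (hdis : Disjoint (cell δ '' B) (cell δ '' A₁))
    (hA : ν (exceptional n r α ε δ A₁) ≤ ENNReal.ofReal (δ ^ ε)) :
    Controlled α ε ((2 * n + 1) ^ n) δ ν (B ∪ A₁) := by
  classical
  obtain ⟨h, hm, hint, hh⟩ := hB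
  set T := toMeasurable ν (exceptional n r α ε δ A₁)
  have hT : MeasurableSet T := measurableSet_toMeasurable _ _
  have hadd : (cells δ (B ∪ A₁) : ℝ≥0∞) = cells δ B + cells δ A₁ := by
    rw [cells_union_of_disjoint hδ hBb hAb hdis]
    push_cast
    rfl
  refine ⟨fun V => h V + T.indicator (fun _ => (cells δ A₁ : ℝ≥0∞)) V,
    hm.add (measurable_const.indicator hT), ?_, ?_⟩
  · rw [lintegral_add_left hm, lintegral_indicator_const hT, measure_toMeasurable, hadd, mul_add,
      mul_comm (cells δ A₁ : ℝ≥0∞)]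
    gcongr
  · intro V B' hB' hlt
    have hB'b : Bornology.IsBounded B' := (hBb.union hAb).subset hB'
    have hproj : ∀ B'' ⊆ B', (cov δ (V.proj '' B'') : ℝ) < δ ^ (-((r : ℝ) / n * α) - ε) := by
      intro B'' hB''
      refine lt_of_le_of_lt ?_ hlt
      exact_mod_cast cov_mono hδ (Set.image_mono hB'') (isBounded_image_proj V hB'b)
    have hcells : (cells δ B' : ℝ≥0∞) ≤ cells δ (B' ∩ B) + cells δ (B' ∩ A₁) := by
      have := cells_union_le (δ := δ) (B' ∩ B) (B' ∩ A₁)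
      rw [← Set.inter_union_distrib_left, Set.inter_eq_left.2 hB'] at this
      exact_mod_cast this
    have h1 := hh V (B' ∩ B) Set.inter_subset_right (hproj _ Set.inter_subset_left)
    have h2 : (cells δ (B' ∩ A₁) : ℝ≥0∞) ≤ ENNReal.ofReal ((2 * n + 1) ^ n * δ ^ ε) *
        (cells δ A₁ : ℝ≥0∞) + T.indicator (fun _ => (cells δ A₁ : ℝ≥0∞)) V := by
      by_cases hV : V ∈ exceptional n r α ε δ A₁
      · rw [Set.indicator_of_mem (subset_toMeasurable _ _ hV)]
        refine le_trans ?_ le_add_self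
        exact_mod_cast cells_mono hδ Set.inter_subset_right hAb
      · refine le_trans ?_ le_self_add
        have hlt' : (cov δ (B' ∩ A₁) : ℝ) < δ ^ ε * cov δ A₁ := by
          by_contra! hcon
          exact hV ⟨B' ∩ A₁, Set.inter_subset_right, hcon, hproj _ Set.inter_subset_left⟩
        have h3 : (cells δ (B' ∩ A₁) : ℝ) ≤ (2 * n + 1) ^ n * cov δ (B' ∩ A₁) := by
          exact_mod_cast cells_le_cov hδ (hAb.subset Set.inter_subset_right)
        have h4 : (cov δ A₁ : ℝ) ≤ cells δ A₁ := by exact_mod_cast cov_le_cells hδ hAb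
        have h5 : (cells δ (B' ∩ A₁) : ℝ) ≤ (2 * n + 1) ^ n * δ ^ ε * cells δ A₁ := by
          calc (cells δ (B' ∩ A₁) : ℝ) ≤ (2 * n + 1) ^ n * (δ ^ ε * cells δ A₁) := by
                refine h3.trans ?_
                gcongr
                exact hlt'.le.trans (by gcongr)
            _ = _ := by ring
        rw [← ENNReal.ofReal_natCast, ← ENNReal.ofReal_natCast (cells δ A₁),
          ← ENNReal.ofReal_mul (by positivity)]
        exact ENNReal.ofReal_le_ofReal h5
    calc (cells δ B' : ℝ≥0∞) ≤ _ := hcells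
      _ ≤ _ := add_le_add h1 h2
      _ = _ := by rw [hadd]; ring

/-- Markov's inequality for the function that controls `B`. -/
lemma Controlled.measure_exceptional_le (hδ : 0 < δ) (hδ1 : δ < 1) {α ε : ℝ} (hε : 0 < ε)
    {ν : Measure (Gr n r)} {B : Set (E n)} (hBb : Bornology.IsBounded B) (hne : B.Nonempty)
    (hsmall : 2 * ((2 * n + 1 : ℝ) ^ n) ^ 2 ≤ δ ^ (-ε))
    (hB : Controlled α (4 * ε) ((2 * n + 1) ^ n) δ ν B) :
    ν (exceptional n r α ε δ B) ≤ ENNReal.ofReal (δ ^ ε) := by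
  obtain ⟨h, hm, hint, hh⟩ := hB
  set P : ℝ := (2 * n + 1 : ℝ) ^ n with hP
  have hP1 : 1 ≤ P := one_le_pow₀ (by linarith [(Nat.cast_nonneg n : (0 : ℝ) ≤ n)])
  have hcpos : (0 : ℝ) < cells δ B := by exact_mod_cast cells_pos hδ hBb hne
  set t : ℝ := δ ^ ε / (2 * P) * cells δ B with ht
  have hδε : 0 < δ ^ ε := Real.rpow_pos_of_pos hδ _
  have htpos : 0 < t := by positivity
  have h4 : δ ^ (4 * ε) * δ ^ (-ε) ≤ δ ^ ε * δ ^ ε := by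
    rw [← Real.rpow_add hδ, ← Real.rpow_add hδ]
    exact Real.rpow_le_rpow_of_exponent_ge hδ hδ1.le (by linarith)
  have h5 : δ ^ (4 * ε) * (2 * P ^ 2) ≤ δ ^ ε * δ ^ ε :=
    (mul_le_mul_of_nonneg_left hsmall (by positivity)).trans h4
  have hδε1 : δ ^ ε ≤ 1 := Real.rpow_le_one hδ.le hδ1.le hε.le
  have hsub : exceptional n r α ε δ B ⊆ {V | ENNReal.ofReal t ≤ h V} := by
    rintro V ⟨B', hB', h1, h2⟩
    have h2' : (cov δ (V.proj '' B') : ℝ) < δ ^ (-((r : ℝ) / n * α) - 4 * ε) :=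
      h2.trans_le (Real.rpow_le_rpow_of_exponent_ge hδ hδ1.le (by linarith))
    have h3 := hh V B' hB' h2'
    have h6 : (cells δ B : ℝ) ≤ P * cov δ B := by
      rw [hP]; exact_mod_cast cells_le_cov hδ hBb
    have h7 : (cov δ B' : ℝ) ≤ cells δ B' := by
      exact_mod_cast cov_le_cells hδ (hBb.subset hB')
    have h8 : 2 * t ≤ cells δ B' := by
      calc 2 * t = δ ^ ε * (cells δ B / P) := by rw [ht]; field_simp
        _ ≤ δ ^ ε * cov δ B := by
          gcongr
          rw [div_le_iff₀ (by positivity)]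
          linarith
        _ ≤ _ := h1.trans h7
    have h9 : P * δ ^ (4 * ε) * cells δ B ≤ t := by
      rw [ht]
      gcongr
      rw [le_div_iff₀ (by positivity)]
      nlinarith
    by_contra hV
    simp only [Set.mem_ofPred_eq, not_le] at hV
    have h10 : (cells δ B' : ℝ≥0∞) < ENNReal.ofReal t + ENNReal.ofReal t := by
      refine h3.trans_lt (ENNReal.add_lt_add_of_le_of_lt ?_ ?_ hV)
      · exact ENNReal.mul_ne_top ENNReal.ofReal_ne_top (ENNReal.natCast_ne_top _)
      · rw [← ENNReal.ofReal_natCast, ← ENNReal.ofReal_mul (by positivity)]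
        exact ENNReal.ofReal_le_ofReal h9
    rw [← ENNReal.ofReal_add htpos.le htpos.le, ← ENNReal.ofReal_natCast,
      ENNReal.ofReal_lt_ofReal_iff (by positivity)] at h10
    linarith
  have hmarkov := mul_meas_ge_le_lintegral (μ := ν) hm (ENNReal.ofReal t)
  have hle : ENNReal.ofReal t * ν {V | ENNReal.ofReal t ≤ h V} ≤
      ENNReal.ofReal t * ENNReal.ofReal (δ ^ ε) := by
    refine hmarkov.trans (hint.trans ?_)
    rw [← ENNReal.ofReal_natCast, ← ENNReal.ofReal_mul (by positivity),
      ← ENNReal.ofReal_mul htpos.le]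
    refine ENNReal.ofReal_le_ofReal ?_
    calc δ ^ (4 * ε) * cells δ B ≤ δ ^ ε / (2 * P) * δ ^ ε * cells δ B := by
          gcongr
          rw [div_mul_eq_mul_div, le_div_iff₀ (by positivity)]
          refine le_trans ?_ h5
          gcongr
          exact le_self_pow₀ hP1 (by norm_num)
      _ = _ := by rw [ht]; ring
  refine (measure_mono hsub).trans ?_
  exact (ENNReal.mul_le_mul_iff_right (by simpa using htpos) ENNReal.ofReal_ne_top).1 hle

/-- The assertion `T(n, r)` puts no lower bound on the size of the subset that it provides.
Exhausting `A` by such subsets, sharing no cells, yields one of size comparable to `A`. -/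
lemma ProjectionTheorem.exists_large_subset (h : ProjectionTheorem n r) {α κ : ℝ} (hα : 0 < α)
    (hαn : α < n) (hκ : 0 < κ) : ∃ ε : ℝ, 0 < ε ∧ ∀ᶠ δ : ℝ in 𝓝[>] 0,
      ∀ (A : Set (E n)) (ν : Measure (Gr n r)), A ⊆ Metric.closedBall 0 1 →
        IsProbabilityMeasure ν → δ ^ (-α + ε) ≤ (cov δ A : ℝ) →
        (∀ ρ : ℝ, δ ≤ ρ → ∀ x : E n,
          (cov δ (A ∩ Metric.closedBall x ρ) : ℝ) ≤ δ ^ (-ε) * ρ ^ κ * (cov δ A : ℝ)) →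
        (∀ ρ : ℝ, δ ≤ ρ → ∀ W : Gr n (n - r),
          ν (Vang W ρ) ≤ ENNReal.ofReal (δ ^ (-ε) * ρ ^ κ)) →
        ∃ A' ⊆ A, (cov δ A : ℝ) ≤ 2 * (2 * n + 1) ^ n * cov δ A' ∧
          ν (exceptional n r α ε δ A') ≤ ENNReal.ofReal (δ ^ ε) := by
  obtain ⟨ε₁, hε₁, δ₀, hδ₀, H⟩ := h α κ hα hαn hκ
  obtain ⟨ε, rfl⟩ : ∃ ε, ε₁ = 4 * ε := ⟨ε₁ / 4, by ring⟩
  have hε : 0 < ε := by linarith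
  refine ⟨ε, hε, ?_⟩
  filter_upwards [eventually_pos_lt_one, eventually_le_rpow_neg (2 * ((2 * n + 1 : ℝ) ^ n) ^ 2) hε,
    Ioo_mem_nhdsGT hδ₀] with δ hδ hsmall hδδ₀ A ν hA hν hcov hfrost hang
  obtain ⟨hδ, hδ1⟩ := hδ
  set P : ℝ := (2 * n + 1 : ℝ) ^ n with hP
  have hP1 : 1 ≤ P := one_le_pow₀ (by linarith [(Nat.cast_nonneg n : (0 : ℝ) ≤ n)])
  have hmono : ∀ {s t : ℝ}, s ≤ t → δ ^ t ≤ δ ^ s := fun hst =>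
    Real.rpow_le_rpow_of_exponent_ge hδ hδ1.le hst
  have hAb : Bornology.IsBounded A := Metric.isBounded_closedBall.subset hA
  -- A controlled subset meeting as many cells as possible exhausts half of `A`: otherwise `T(n, r)`
  -- applies to the part `A₂` of `A` outside its cells, and enlarges it.
  let sizes : Set ℕ := {k | ∃ B ⊆ A, Controlled α (4 * ε) P δ ν B ∧ cells δ B = k}
  have hbdd : BddAbove sizes := by
    refine ⟨cells δ A, ?_⟩
    rintro _ ⟨B, hB, -, rfl⟩
    exact cells_mono hδ hB hAb
  obtain ⟨B, hBA, hB, hBmax⟩ : sSup sizes ∈ sizes :=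
    Nat.sSup_mem ⟨_, ∅, Set.empty_subset _, controlled_empty α (4 * ε) P ν, rfl⟩ hbdd
  have hBb := hAb.subset hBA
  set A₂ := {x ∈ A | cell δ x ∉ cell δ '' B} with hA₂
  have hA₂A : A₂ ⊆ A := fun x hx => hx.1
  have hA₂b := hAb.subset hA₂A
  have hA₂small : 2 * cells δ A₂ < cells δ A := by
    by_contra! hcon
    have h1 : (cov δ A : ℝ) ≤ δ ^ (-ε) * cov δ A₂ := by
      have e1 : (cov δ A : ℝ) ≤ cells δ A := by exact_mod_cast cov_le_cells hδ hAb
      have e2 : (cells δ A : ℝ) ≤ 2 * cells δ A₂ := by exact_mod_cast hcon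
      have e3 : (cells δ A₂ : ℝ) ≤ P * cov δ A₂ := by
        rw [hP]; exact_mod_cast cells_le_cov hδ hA₂b
      calc (cov δ A : ℝ) ≤ 2 * P * cov δ A₂ := by linarith
        _ ≤ _ := by
          gcongr
          refine le_trans ?_ hsmall
          gcongr
          exact le_self_pow₀ hP1 (by norm_num)
    obtain ⟨A₁, hA₁, hA₁ν⟩ : ∃ A₁ ⊆ A₂,
        ν (exceptional n r α (4 * ε) δ A₁) ≤ ENNReal.ofReal (δ ^ (4 * ε)) := by
      refine H δ hδ hδδ₀.2 A₂ ν (hA₂A.trans hA) hν ?_ ?_ ?_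
      · have e1 : δ ^ ε * cov δ A ≤ cov δ A₂ := by
          calc δ ^ ε * (cov δ A : ℝ) ≤ δ ^ ε * (δ ^ (-ε) * cov δ A₂) := by gcongr
            _ = cov δ A₂ := by rw [← mul_assoc, ← Real.rpow_add hδ]; simp
        refine le_trans ?_ e1
        calc δ ^ (-α + 4 * ε) ≤ δ ^ (ε + (-α + ε)) := hmono (by linarith)
          _ = δ ^ ε * δ ^ (-α + ε) := Real.rpow_add hδ _ _
          _ ≤ _ := by gcongr
      · intro ρ hρ x
        have hρ0 : 0 < ρ := hδ.trans_le hρ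
        have e1 : (cov δ (A₂ ∩ Metric.closedBall x ρ) : ℝ) ≤ cov δ (A ∩ Metric.closedBall x ρ) := by
          exact_mod_cast cov_mono hδ (Set.inter_subset_inter_left _ hA₂A)
            (hAb.subset Set.inter_subset_left)
        calc _ ≤ δ ^ (-ε) * ρ ^ κ * (cov δ A : ℝ) := e1.trans (hfrost ρ hρ x)
          _ ≤ δ ^ (-ε) * ρ ^ κ * (δ ^ (-ε) * cov δ A₂) := by gcongr
          _ = δ ^ (-ε + -ε) * ρ ^ κ * cov δ A₂ := by rw [Real.rpow_add hδ]; ring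
          _ ≤ _ := by
            gcongr ?_ * _ * _
            exact hmono (by linarith)
      · intro ρ hρ W
        have hρ0 : 0 < ρ := hδ.trans_le hρ
        refine (hang ρ hρ W).trans (ENNReal.ofReal_le_ofReal ?_)
        gcongr ?_ * _
        exact hmono (by linarith)
    have hA₁b := hA₂b.subset hA₁
    have hne : A₁.Nonempty := by
      rw [Set.nonempty_iff_ne_empty]
      rintro rfl
      rw [exceptional_empty hδ, measure_univ, ← ENNReal.ofReal_one,
        ENNReal.ofReal_le_ofReal_iff (by positivity)] at hA₁ν
      linarith [Real.rpow_lt_one hδ.le hδ1 hε₁]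
    have hdis : Disjoint (cell δ '' B) (cell δ '' A₁) := by
      rw [Set.disjoint_right]
      rintro _ ⟨x, hx, rfl⟩
      exact (hA₁ hx).2
    have h2 : cells δ (B ∪ A₁) ≤ sSup sizes :=
      le_csSup hbdd ⟨B ∪ A₁, Set.union_subset hBA (hA₁.trans hA₂A),
        hB.union hδ hBb hA₁b hdis hA₁ν, rfl⟩
    rw [cells_union_of_disjoint hδ hBb hA₁b hdis, ← hBmax] at h2
    have := cells_pos hδ hA₁b hne
    omega
  have hsplit : cells δ A ≤ cells δ B + cells δ A₂ := by
    have hsub : cell δ '' A ⊆ cell δ '' B ∪ cell δ '' A₂ := by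
      rintro _ ⟨x, hx, rfl⟩
      by_cases hxB : cell δ x ∈ cell δ '' B
      · exact Or.inl hxB
      · exact Or.inr ⟨x, ⟨hx, hxB⟩, rfl⟩
    exact (Set.ncard_le_ncard hsub ((finite_cell_image hδ hBb).union
      (finite_cell_image hδ hA₂b))).trans (Set.ncard_union_le _ _)
  have hBlarge : (cov δ A : ℝ) ≤ 2 * P * cov δ B := by
    have e1 : (cov δ A : ℝ) ≤ cells δ A := by exact_mod_cast cov_le_cells hδ hAb
    have e2 : (cells δ A : ℝ) ≤ 2 * cells δ B := by exact_mod_cast (by omega)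
    have e3 : (cells δ B : ℝ) ≤ P * cov δ B := by
      rw [hP]; exact_mod_cast cells_le_cov hδ hBb
    linarith
  refine ⟨B, hBA, hBlarge, hB.measure_exceptional_le hδ hδ1 hε hBb ?_ hsmall⟩
  rw [Set.nonempty_iff_ne_empty]
  rintro rfl
  have : (0 : ℝ) < cov δ A := (Real.rpow_pos_of_pos hδ _).trans_le hcov
  have hzero : cov δ (∅ : Set (E n)) = 0 := by simp [cov]
  rw [hzero, Nat.cast_zero, mul_zero] at hBlarge
  linarith

end

/-! ### Laws of intersections of independent random subspaces -/

section Intersection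

variable {n m a b : ℕ} {δ : ℝ}

lemma exists_measure_not_transversal_le (n : ℕ) : ∃ C : ℝ, 1 ≤ C ∧ ∀ (m : ℕ) (δ ε κ : ℝ), 0 < δ →
    0 < κ → ∀ μ : Measure (Gr n m),
    (∀ ρ : ℝ, δ ≤ ρ → ∀ W : Gr n (n - m), μ (Vang W ρ) ≤ ENNReal.ofReal (δ ^ (-ε) * ρ ^ κ)) →
    ∀ W : Submodule ℝ (E n), Module.finrank ℝ W + m = n → ∀ c, δ ≤ c →
      μ {V | ¬ Transversal c V.1 W} ≤ ENNReal.ofReal (C ^ κ * δ ^ (-ε) * c ^ κ) := by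
  obtain ⟨C, hC, H⟩ := exists_dang_le_of_not_transversal n
  refine ⟨C, hC, fun m δ ε κ hδ hκ μ hμ W hW c hc => ?_⟩
  have hc0 : 0 < c := hδ.trans_le hc
  let W₁ : Gr n (n - m) := ⟨W, by omega⟩
  calc μ {V | ¬ Transversal c V.1 W} ≤ μ (Vang W₁ (C * c)) :=
        measure_mono fun V hV => H m V W₁ c hV
    _ ≤ ENNReal.ofReal (δ ^ (-ε) * (C * c) ^ κ) := hμ _ (by nlinarith) W₁
    _ = _ := by rw [Real.mul_rpow (by linarith) hc0.le]; ring_nf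

lemma finrank_inf_eq_of_transversal {U V W W' : Submodule ℝ (E n)} {c : ℝ} (hc : 0 < c) (hW : W' ≤ W)
    (hdimW : Module.finrank ℝ W + b = n) (hdimW' : Module.finrank ℝ W' + a = n)
    (hdimU : Module.finrank ℝ U = a) (hdimV : Module.finrank ℝ V = m) (hab : a + m = n + b)
    (hU : Transversal c U W') (hV : Transversal c V (U ⊓ W)) :
    Module.finrank ℝ (U ⊓ V : Submodule ℝ (E n)) = b := by
  have h1 := hU.finrank_inf hc hW (by omega)
  have h3 := hV.sup_eq_top hc (by omega)
  have h4 : U ⊔ V = ⊤ := by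
    rw [eq_top_iff, ← h3]
    exact sup_le le_sup_right (inf_le_left.trans le_sup_left)
  have h5 := Submodule.finrank_sup_add_finrank_inf_eq U V
  rw [h4, finrank_top, finrank_euclideanSpace_fin] at h5
  omega

lemma ofReal_half_le_of_le_add {x y : ℝ} {M : ℝ≥0∞} (hx : 0 ≤ x) (hy : y ≤ x / 2)
    (h : ENNReal.ofReal x ≤ M + ENNReal.ofReal y) : ENNReal.ofReal (x / 2) ≤ M := by
  have h1 : ENNReal.ofReal (x / 2) + ENNReal.ofReal (x / 2) ≤ M + ENNReal.ofReal (x / 2) := by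
    rw [← ENNReal.ofReal_add (by linarith) (by linarith), add_halves]
    exact h.trans (by gcongr)
  exact (ENNReal.add_le_add_iff_right ENNReal.ofReal_ne_top).1 h1

/-- If a large part of `A'` has small projections to `U` and to `V`, and `U` and `V` are
transverse, then submodularity makes `U ⊓ V` an exceptional direction of `A'`. -/
lemma exists_mem_exceptional_of_inf (n : ℕ) : ∃ C : ℝ, 1 ≤ C ∧
    ∀ (a b m : ℕ) (δ α η₀ η s : ℝ), 0 < δ → δ < 1 → 0 < η₀ → C ≤ δ ^ (-η₀) → 3 * η₀ ≤ η →
    6 * η₀ + s * n ≤ η → 0 ≤ s → a + m = n + b → 0 < b →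
    ∀ (U : Gr n a) (V : Gr n m) (I : Gr n b), I.1 = U.1 ⊓ V.1 →
    (∀ x, ∀ η, ‖U.proj x‖ ≤ η → ‖V.proj x‖ ≤ η → ‖x‖ ≤ 3 / δ ^ s * η) →
    ∀ A' A₁ A₂ : Set (E n), Bornology.IsBounded A' → A₁ ⊆ A' → A₂ ⊆ A₁ →
    δ ^ (-α + η₀) ≤ cov δ A' →
    δ ^ η₀ * (cov δ A' : ℝ) ≤ cov δ A₁ →
    (cov δ (U.proj '' A₁) : ℝ) < δ ^ (-((a : ℝ) / n * α) - η₀) →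
    δ ^ η₀ * (cov δ A₁ : ℝ) ≤ cov δ A₂ →
    (cov δ (V.proj '' A₂) : ℝ) < δ ^ (-((m : ℝ) / n * α) - η₀) →
    I ∈ exceptional n b α η δ A' := by
  obtain ⟨C, hC, H⟩ := exists_subset_cov_mul_cov_inf_le n
  refine ⟨C * 3 ^ n, one_le_mul_of_one_le_of_one_le hC (one_le_pow₀ (by norm_num)), ?_⟩
  intro a b m δ α η₀ η s hδ hδ1 hη₀ hCδ hη₀η hηs hs hab hb U V I hI hUV A' A₁ A₂ hA' hA₁ hA₂
    hcov' hcov₁ hU₁ hcov₂ hV₂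
  have hbn : b ≤ n := I.le
  have hn : (0 : ℝ) < n := by exact_mod_cast (by omega : 0 < n)
  have hmono : ∀ {s t : ℝ}, s ≤ t → δ ^ t ≤ δ ^ s := fun hst =>
    Real.rpow_le_rpow_of_exponent_ge hδ hδ1.le hst
  have hpos : ∀ t : ℝ, 0 < δ ^ t := fun t => Real.rpow_pos_of_pos hδ t
  have hδs : δ ^ s ≤ 1 := Real.rpow_le_one hδ.le hδ1.le hs
  have hA₁b := hA'.subset hA₁
  have hA₂b := hA₁b.subset hA₂
  obtain ⟨A₃, hA₃, h1, h2⟩ := H δ hδ U.1 V.1 (3 / δ ^ s)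
    (by rw [le_div_iff₀ (hpos s)]; linarith) hUV A₂ hA₂b
  have hproj : I.proj = (U.1 ⊓ V.1).starProjection := by
    have key : ∀ Y : Submodule ℝ (E n), I.1 = Y → I.proj = Y.starProjection := by
      rintro _ rfl
      rfl
    exact key _ hI
  have hC1 : C ≤ δ ^ (-η₀) := by
    refine le_trans ?_ hCδ
    exact le_mul_of_one_le_right (by linarith) (one_le_pow₀ (by norm_num))
  have h3 : δ ^ (η₀ + η₀) * (cov δ A' : ℝ) ≤ cov δ A₂ := by
    refine le_trans ?_ hcov₂
    rw [Real.rpow_add hδ, mul_assoc]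
    gcongr
  refine ⟨A₃, hA₃.trans (hA₂.trans hA₁), ?_, ?_⟩
  · have h4 : δ ^ (η₀ + η₀) * (cov δ A' : ℝ) ≤ δ ^ (-η₀) * cov δ A₃ :=
      h3.trans (h1.trans (by gcongr))
    calc δ ^ η * (cov δ A' : ℝ) ≤ δ ^ (η₀ + (η₀ + η₀)) * cov δ A' := by
          gcongr ?_ * _
          exact hmono (by linarith)
      _ = δ ^ η₀ * (δ ^ (η₀ + η₀) * cov δ A') := by rw [Real.rpow_add hδ η₀, mul_assoc]
      _ ≤ δ ^ η₀ * (δ ^ (-η₀) * cov δ A₃) := by gcongr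
      _ = cov δ A₃ := by rw [← mul_assoc, ← Real.rpow_add hδ]; simp
  · have h4 : (cov δ (U.proj '' A₂) : ℝ) < δ ^ (-((a : ℝ) / n * α) - η₀) := by
      refine lt_of_le_of_lt ?_ hU₁
      exact_mod_cast cov_mono hδ (Set.image_mono hA₂) (isBounded_image_proj U hA₁b)
    have h5 : δ ^ (-α + 3 * η₀) ≤ (cov δ A₂ : ℝ) := by
      refine le_trans ?_ h3
      calc δ ^ (-α + 3 * η₀) = δ ^ (η₀ + η₀) * δ ^ (-α + η₀) := by
            rw [← Real.rpow_add hδ]; ring_nf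
        _ ≤ _ := by gcongr
    have hCK : C * (3 / δ ^ s) ^ n ≤ δ ^ (-η₀ - s * n) := by
      rw [div_pow, ← mul_div_assoc, div_le_iff₀ (by positivity), ← Real.rpow_natCast (δ ^ s),
        ← Real.rpow_mul hδ.le, ← Real.rpow_add hδ]
      simpa using hCδ
    have hba : (b : ℝ) / n * α = (a : ℝ) / n * α + (m : ℝ) / n * α - α := by
      have : (a : ℝ) + m = n + b := by exact_mod_cast hab
      rw [eq_sub_of_add_eq' this.symm]
      field_simp
    rw [hproj]
    by_contra! hcon
    have h6 : δ ^ (-α + 3 * η₀) * δ ^ (-((b : ℝ) / n * α) - η) ≤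
        (cov δ A₂ : ℝ) * cov δ ((U.1 ⊓ V.1).starProjection '' A₃) := by gcongr
    have h7 : C * (3 / δ ^ s) ^ n * (cov δ (U.proj '' A₂) * cov δ (V.proj '' A₂)) <
        δ ^ (-η₀ - s * n) *
          (δ ^ (-((a : ℝ) / n * α) - η₀) * δ ^ (-((m : ℝ) / n * α) - η₀)) := by
      refine mul_lt_mul' hCK (mul_lt_mul'' h4 hV₂ (by positivity) (by positivity))
        (by positivity) (hpos _)
    have h8 := (h6.trans h2).trans_lt h7
    rw [← Real.rpow_add hδ, ← Real.rpow_add hδ, ← Real.rpow_add hδ] at h8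
    refine absurd h8 (not_lt.2 (hmono ?_))
    rw [hba]
    linarith

/-- `IntersectionLaw n m a α κ κ'` says that every non-concentrated law `μ` on `Gr(ℝⁿ, m)` induces a
law `ν` on `Gr(ℝⁿ, a)`, non-concentrated with the exponent `κ'`, such that a set all of whose
subsets have many exceptional `m`-dimensional directions for `μ` has many exceptional
`a`-dimensional directions for `ν`. It holds when generic intersections of boundedly many
`m`-dimensional subspaces have dimension `a > 0`, the law `ν` being that of an intersection of
independent random subspaces. The dimension of `W` is complementary to `a`. -/
def IntersectionLaw (n m a : ℕ) (α κ κ' : ℝ) : Prop :=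
  ∀ η : ℝ, 0 < η → ∃ ε : ℝ, 0 < ε ∧ ∀ᶠ δ : ℝ in 𝓝[>] 0, ∀ μ : Measure (Gr n m),
    IsProbabilityMeasure μ →
    (∀ ρ : ℝ, δ ≤ ρ → ∀ W : Gr n (n - m), μ (Vang W ρ) ≤ ENNReal.ofReal (δ ^ (-ε) * ρ ^ κ)) →
    ∃ ν : Measure (Gr n a), IsProbabilityMeasure ν ∧
      (∀ W : Submodule ℝ (E n), Module.finrank ℝ W + a = n → ∀ c, δ ≤ c → c ≤ 1 →
        ν {U | ¬ Transversal c U.1 W} ≤ ENNReal.ofReal (δ ^ (-η) * c ^ κ')) ∧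
      ∀ A ⊆ Metric.closedBall (0 : E n) 1,
        (∀ A' ⊆ A, ENNReal.ofReal (δ ^ ε) ≤ μ (exceptional n m α ε δ A')) →
        ∀ A' ⊆ A, δ ^ (-α + ε) ≤ (cov δ A' : ℝ) →
          ENNReal.ofReal (δ ^ η) ≤ ν (exceptional n a α η δ A')

lemma intersectionLaw_self (n m : ℕ) (α : ℝ) {κ : ℝ} (hκ : 0 < κ) :
    IntersectionLaw n m m α κ κ := by
  obtain ⟨C, hC, H⟩ := exists_measure_not_transversal_le n
  intro η hη
  refine ⟨η / 2, by positivity, ?_⟩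
  filter_upwards [eventually_pos_lt_one, eventually_le_rpow_neg (C ^ κ) (half_pos hη)]
    with δ ⟨hδ, hδ1⟩ hCδ μ hμ hang
  refine ⟨μ, hμ, fun W hW c hc hc1 => ?_, fun A _ hexc A' hA' _ => ?_⟩
  · have hc0 : 0 < c := hδ.trans_le hc
    refine (H m δ (η / 2) κ hδ hκ μ hang W hW c hc).trans (ENNReal.ofReal_le_ofReal ?_)
    gcongr
    calc C ^ κ * δ ^ (-(η / 2)) ≤ δ ^ (-(η / 2)) * δ ^ (-(η / 2)) := by gcongr
      _ = δ ^ (-η) := by rw [← Real.rpow_add hδ]; ring_nf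
  · calc ENNReal.ofReal (δ ^ η) ≤ ENNReal.ofReal (δ ^ (η / 2)) :=
          ENNReal.ofReal_le_ofReal (Real.rpow_le_rpow_of_exponent_ge hδ hδ1.le (by linarith))
      _ ≤ _ := hexc A' hA'
      _ ≤ _ := measure_mono (exceptional_mono hδ hδ1 (by linarith) A')

/-- Intersecting with one more independent random subspace. -/
lemma IntersectionLaw.inter {α κ κ' : ℝ} (h : IntersectionLaw n m a α κ κ') (hκ' : 0 < κ')
    (hκκ' : κ' ≤ κ) (hmn : m ≤ n) (hab : a + m = n + b) (hb : 0 < b) (hbn : b ≤ n) (han : a ≤ n) :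
    IntersectionLaw n m b α κ (κ' / 2) := by
  obtain ⟨C₁, hC₁, H₁⟩ := exists_measure_not_transversal_le n
  obtain ⟨C₂, hC₂, H₂⟩ := exists_mem_exceptional_of_inf n
  have hκ : 0 < κ := hκ'.trans_le hκκ'
  have hC₁κ : 1 ≤ C₁ ^ κ := Real.one_le_rpow hC₁ hκ.le
  obtain ⟨D₀, -, hD₀⟩ := exists_submodule_le_finrank_eq (⊤ : Submodule ℝ (E n)) (k := b)
    (by simpa using hbn)
  have hexW : ∀ W : Submodule ℝ (E n), Module.finrank ℝ W + b = n →
      ∃ W' ≤ W, Module.finrank ℝ W' + a = n := by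
    intro W hW
    obtain ⟨W', hW', hdim⟩ := exists_submodule_le_finrank_eq W (k := n - a) (by omega)
    exact ⟨W', hW', by omega⟩
  let D : Gr n b := ⟨D₀, hD₀⟩
  intro η hη
  -- At the scale `c = δ ^ s` the pairs that are not transverse have probability about
  -- `δ ^ (s * κ' - η₀) = δ ^ (2 * η₀)`, negligible against `δ ^ η₀`.
  obtain ⟨η₀, hη₀, hη₀κ, hη₀η⟩ : ∃ η₀ : ℝ, 0 < η₀ ∧ 3 * η₀ ≤ κ' ∧
      6 * η₀ + 3 * η₀ / κ' * n ≤ η := by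
    refine ⟨min (κ' / 3) (η / (6 + 3 / κ' * n)), lt_min (by positivity) (by positivity), ?_, ?_⟩
    · linarith [min_le_left (κ' / 3) (η / (6 + 3 / κ' * n))]
    · have h1 := min_le_right (κ' / 3) (η / (6 + 3 / κ' * n))
      rw [le_div_iff₀ (by positivity)] at h1
      refine le_of_eq_of_le ?_ h1
      ring
  set s := 3 * η₀ / κ' with hs
  have hs0 : 0 ≤ s := by positivity
  have hs1 : s ≤ 1 := by rw [hs, div_le_one hκ']; exact hη₀κ
  have hsκ : s * κ' = 3 * η₀ := by rw [hs]; field_simp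
  have hη₀3 : 3 * η₀ ≤ η := by
    have : 0 ≤ s * n := by positivity
    linarith
  obtain ⟨ε₀, hε₀, hlaw⟩ := h η₀ hη₀
  set ε := min ε₀ η₀ with hε
  have hεε₀ : ε ≤ ε₀ := min_le_left _ _
  have hεη₀ : ε ≤ η₀ := min_le_right _ _
  refine ⟨ε, lt_min hε₀ hη₀, ?_⟩
  filter_upwards [eventually_pos_lt_one, hlaw, eventually_le_rpow_neg (4 * C₁ ^ κ) hη₀,
    eventually_le_rpow_neg C₂ hη₀] with δ ⟨hδ, hδ1⟩ hlawδ hC₁δ hC₂δ μ hμ hang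
  have hmono : ∀ {s t : ℝ}, s ≤ t → δ ^ t ≤ δ ^ s := fun hst =>
    Real.rpow_le_rpow_of_exponent_ge hδ hδ1.le hst
  obtain ⟨ν, hν, hνconc, hνexc⟩ := hlawδ μ hμ fun ρ hρ W => by
    have hρ0 : 0 < ρ := hδ.trans_le hρ
    refine (hang ρ hρ W).trans (ENNReal.ofReal_le_ofReal ?_)
    gcongr ?_ * _
    exact hmono (by linarith)
  have hμconc : ∀ W : Submodule ℝ (E n), Module.finrank ℝ W + m = n → ∀ c, δ ≤ c → c ≤ 1 →
      μ {V | ¬ Transversal c V.1 W} ≤ ENNReal.ofReal (C₁ ^ κ * δ ^ (-η₀) * c ^ κ') := by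
    intro W hW c hc hc1
    have hc0 : 0 < c := hδ.trans_le hc
    refine (H₁ m δ ε κ hδ hκ μ hang W hW c hc).trans (ENNReal.ofReal_le_ofReal ?_)
    gcongr C₁ ^ κ * ?_ * ?_
    · exact hmono (by linarith)
    · exact Real.rpow_le_rpow_of_exponent_ge hc0 hc1 hκκ'
  have hinter : Measurable (Gr.inter D : Gr n a × Gr n m → Gr n b) := Gr.measurable_inter D
  refine ⟨(ν.prod μ).map (Gr.inter D), Measure.isProbabilityMeasure_map hinter.aemeasurable,
    fun W hW c hc hc1 => ?_, fun A hA hexc A' hA' hcov => ?_⟩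
  · have hc0 : 0 < c := hδ.trans_le hc
    obtain ⟨W', hW'W, hW'⟩ := hexW W hW
    have hsq0 : 0 < √c := Real.sqrt_pos.2 hc0
    have hsq1 : √c ≤ 1 := Real.sqrt_le_one.2 hc1
    have hsqc : c ≤ √c := by
      calc c = √c * √c := (Real.mul_self_sqrt hc0.le).symm
        _ ≤ √c * 1 := by gcongr
        _ = √c := mul_one _
    have hmeas : MeasurableSet {U : Gr n b | ¬ Transversal c U.1 W} :=
      (measurableSet_transversal c W).compl
    refine (map_prod_le_add ν μ hinter hmeas {U | ¬ Transversal (√c) U.1 W'}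
      (p := ENNReal.ofReal (C₁ ^ κ * δ ^ (-η₀) * √c ^ κ')) fun U hU => ?_).trans ?_
    · have hU' : Transversal (√c) U.1 W' := not_not.1 hU
      have hdimUW : Module.finrank ℝ (U.1 ⊓ W : Submodule ℝ (E n)) + m = n := by
        have h1 := hU'.finrank_inf hsq0 hW'W (by have := U.2; omega)
        omega
      refine (measure_mono fun V hV => ?_).trans
        (hμconc (U.1 ⊓ W) hdimUW (√c) (hc.trans hsqc) hsq1)
      intro hVt
      refine hV ?_
      have h1 : (Gr.inter D (U, V)).1 = U.1 ⊓ V.1 :=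
        Gr.inter_val (finrank_inf_eq_of_transversal hsq0 hW'W hW hW' U.2 V.2 hab hU' hVt)
      have h2 := hU'.inf hsq0 hW'W hVt (by have := U.2; omega)
      rw [Real.mul_self_sqrt hc0.le, ← h1] at h2
      exact h2
    · refine (add_le_add_left (hνconc W' hW' (√c) (hc.trans hsqc) hsq1) _).trans ?_
      rw [← ENNReal.ofReal_add (by positivity) (by positivity)]
      refine ENNReal.ofReal_le_ofReal ?_
      have h1 : √c ^ κ' = c ^ (κ' / 2) := by
        rw [Real.sqrt_eq_rpow, ← Real.rpow_mul hc0.le]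
        ring_nf
      rw [h1]
      calc δ ^ (-η₀) * c ^ (κ' / 2) + C₁ ^ κ * δ ^ (-η₀) * c ^ (κ' / 2)
          = (1 + C₁ ^ κ) * δ ^ (-η₀) * c ^ (κ' / 2) := by ring
        _ ≤ δ ^ (-η₀) * δ ^ (-η₀) * c ^ (κ' / 2) := by gcongr; linarith
        _ = δ ^ (-η₀ + -η₀) * c ^ (κ' / 2) := by rw [Real.rpow_add hδ]
        _ ≤ _ := by
          gcongr ?_ * _
          exact hmono (by linarith)
  · obtain ⟨W, -, hWdim⟩ := exists_submodule_le_finrank_eq (⊤ : Submodule ℝ (E n)) (k := n - b)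
      (by simp)
    have hW : Module.finrank ℝ W + b = n := by omega
    obtain ⟨W', hW'W, hW'⟩ := hexW W hW
    have hA'b : Bornology.IsBounded A' := Metric.isBounded_closedBall.subset (hA'.trans hA)
    set c := δ ^ s with hc
    have hc0 : 0 < c := Real.rpow_pos_of_pos hδ s
    have hc1 : c ≤ 1 := Real.rpow_le_one hδ.le hδ1.le hs0
    have hδc : δ ≤ c := by
      calc δ = δ ^ (1 : ℝ) := (Real.rpow_one δ).symm
        _ ≤ c := hmono hs1
    have hcκ : δ ^ (-η₀) * c ^ κ' = δ ^ η₀ * δ ^ η₀ := by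
      rw [hc, ← Real.rpow_mul hδ.le, hsκ, ← Real.rpow_add hδ, ← Real.rpow_add hδ]
      ring_nf
    have hfour : 4 * C₁ ^ κ * δ ^ η₀ ≤ 1 := by
      calc 4 * C₁ ^ κ * δ ^ η₀ ≤ δ ^ (-η₀) * δ ^ η₀ := by gcongr
        _ = 1 := by rw [← Real.rpow_add hδ]; simp
    have hδη₀ : 0 < δ ^ η₀ := Real.rpow_pos_of_pos hδ _
    have hpν : δ ^ (-η₀) * c ^ κ' ≤ δ ^ η₀ / 2 := by
      rw [hcκ]
      nlinarith
    have hpμ : C₁ ^ κ * δ ^ (-η₀) * c ^ κ' ≤ δ ^ η₀ / 2 := by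
      rw [mul_assoc, hcκ]
      nlinarith
    set G : Set (Gr n a) := exceptional n a α η₀ δ A' ∩ {U | Transversal c U.1 W'} with hG
    have hνG : ENNReal.ofReal (δ ^ η₀ / 2) ≤ ν G := by
      refine ofReal_half_le_of_le_add hδη₀.le hpν ?_
      have h1 := hνexc A hA (fun B hB => ?_) A' hA' ((hmono (by linarith)).trans hcov)
      · refine h1.trans ((measure_mono ?_).trans ((measure_union_le G _).trans
          (add_le_add_right (hνconc W' hW' c hδc hc1) _)))
        intro U hU
        by_cases hUW : Transversal c U.1 W'
        · exact Or.inl ⟨hU, hUW⟩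
        · exact Or.inr hUW
      · exact (ENNReal.ofReal_le_ofReal (hmono hεε₀)).trans ((hexc B hB).trans
          (measure_mono (exceptional_mono hδ hδ1 hεε₀ B)))
    have hfib : ∀ U ∈ G, ENNReal.ofReal (δ ^ η₀ / 2) ≤
        μ {V | Gr.inter D (U, V) ∈ exceptional n b α η δ A'} := by
      rintro U ⟨⟨A₁, hA₁, hcov₁, hproj₁⟩, hUW⟩
      have hUW' : Transversal c U.1 W' := hUW
      have hdimUW : Module.finrank ℝ (U.1 ⊓ W : Submodule ℝ (E n)) + m = n := by
        have h1 := hUW'.finrank_inf hc0 hW'W (by have := U.2; omega)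
        omega
      refine ofReal_half_le_of_le_add hδη₀.le hpμ ?_
      refine (ENNReal.ofReal_le_ofReal (hmono hεη₀)).trans ((hexc A₁ (hA₁.trans hA')).trans
        ((measure_mono ?_).trans ((measure_union_le _ _).trans
          (add_le_add_right (hμconc (U.1 ⊓ W) hdimUW c hδc hc1) _))))
      intro V hV
      by_cases hVt : Transversal c V.1 (U.1 ⊓ W)
      · refine Or.inl ?_
        obtain ⟨A₂, hA₂, hcov₂, hproj₂⟩ := exceptional_mono hδ hδ1 hεη₀ A₁ hV
        exact H₂ a b m δ α η₀ η s hδ hδ1 hη₀ hC₂δ hη₀3 hη₀η hs0 hab hb U V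
          (Gr.inter D (U, V))
          (Gr.inter_val (finrank_inf_eq_of_transversal hc0 hW'W hW hW' U.2 V.2 hab hUW' hVt))
          (hVt.norm_le_of_starProjection_le hc0 hc1 inf_le_left (by have := V.2; omega))
          A' A₁ A₂ hA'b hA₁ hA₂ ((hmono (by linarith)).trans hcov) hcov₁ hproj₁ hcov₂ hproj₂
      · exact Or.inr hVt
    have hmain := mul_le_map_prod ν μ hinter G hfib
    refine le_trans ?_ ((mul_le_mul_right hνG _).trans hmain)
    rw [← ENNReal.ofReal_mul (by positivity)]
    refine ENNReal.ofReal_le_ofReal ?_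
    have h4 : 4 * δ ^ η₀ ≤ 1 := by nlinarith
    calc δ ^ η ≤ δ ^ (η₀ + (η₀ + η₀)) := hmono (by linarith)
      _ = δ ^ η₀ * (δ ^ η₀ * δ ^ η₀) := by rw [Real.rpow_add hδ, Real.rpow_add hδ]
      _ ≤ _ := by nlinarith [mul_pos hδη₀ hδη₀]

end Intersection

/-- Non-concentration with respect to `Transversal` implies non-concentration with respect to
`dang`, with a smaller exponent. -/
lemma exists_measure_Vang_le (n : ℕ) {κ' : ℝ} (hn : 0 < n) (hκ' : 0 < κ') : ∃ C : ℝ,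
    ∀ (a : ℕ) (δ η : ℝ), 0 < δ → δ < 1 → 0 < η → ∀ ν : Measure (Gr n a),
    IsProbabilityMeasure ν →
    (∀ W : Submodule ℝ (E n), Module.finrank ℝ W + a = n → ∀ c, δ ≤ c → c ≤ 1 →
        ν {U | ¬ Transversal c U.1 W} ≤ ENNReal.ofReal (δ ^ (-η) * c ^ κ')) →
    ∀ ρ, δ ≤ ρ → ∀ W : Gr n (n - a),
      ν (Vang W ρ) ≤ ENNReal.ofReal (C * δ ^ (-η) * ρ ^ (κ' / n)) := by
  obtain ⟨C, hC, H⟩ := exists_pow_le_dang_of_transversal n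
  refine ⟨(2 * C) ^ (κ' / n), fun a δ η hδ hδ1 hη ν hν hconc ρ hρ W => ?_⟩
  have hρ0 : 0 < ρ := hδ.trans_le hρ
  have hn' : (0 : ℝ) < n := by exact_mod_cast hn
  set c := (2 * C * ρ) ^ (1 / (n : ℝ)) with hc
  have hCρ : 0 < 2 * C * ρ := by positivity
  have hc0 : 0 < c := Real.rpow_pos_of_pos hCρ _
  have hcn : c ^ n = 2 * C * ρ := by
    rw [hc, ← Real.rpow_natCast, ← Real.rpow_mul hCρ.le, one_div, inv_mul_cancel₀ hn'.ne',
      Real.rpow_one]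
  have hcκ : (2 * C) ^ (κ' / n) * δ ^ (-η) * ρ ^ (κ' / n) = δ ^ (-η) * c ^ κ' := by
    rw [hc, ← Real.rpow_mul hCρ.le, Real.mul_rpow (by positivity) hρ0.le]
    ring_nf
  rw [hcκ]
  rcases le_or_gt c 1 with hc1 | hc1
  · have hδc : δ ≤ c := by
      have h1 : c ^ n ≤ c := pow_le_of_le_one hc0.le hc1 hn.ne'
      rw [hcn] at h1
      nlinarith
    refine (measure_mono fun U hU => ?_).trans (hconc W.1 ?_ c hδc hc1)
    · intro hUt
      have h1 := H a U W c hc0 hc1 hUt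
      have h2 : dang U W ≤ ρ := hU
      rw [hcn] at h1
      nlinarith
    · have := W.2
      rw [this]
      obtain ⟨U⟩ : Nonempty (Gr n a) := nonempty_of_isProbabilityMeasure ν
      have := U.le
      omega
  · refine prob_le_one.trans ?_
    rw [← ENNReal.ofReal_one]
    refine ENNReal.ofReal_le_ofReal ?_
    exact one_le_mul_of_one_le_of_one_le
      (Real.one_le_rpow_of_pos_of_le_one_of_nonpos hδ hδ1.le (by linarith))
      (Real.one_le_rpow hc1.le hκ'.le)

end DiscProj

end

/-! ### Deduction of `T(n, m)` from `T(n, r)` -/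

open DiscProj in
theorem proposition10 (n m q r : ℕ) (hm : 0 < m) (hmn : m < n) (hq : 1 ≤ q)
    (hn : n = q * (n - m) + r) (hr : 0 < r) (hrm : r ≤ n - m)
    (h : DiscProj.ProjectionTheorem n r) :
    DiscProj.ProjectionTheorem n m := by
  intro α κ hα hαn hκ
  have hn0 : 0 < n := by omega
  -- The law of the intersection of `k + 1` independent random subspaces.
  have hlaw : ∀ k : ℕ, ∀ a : ℕ, a + (k + 1) * (n - m) = n → 0 < a →
      IntersectionLaw n m a α κ (κ / 2 ^ k) := by
    intro k
    induction k with
    | zero =>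
      intro a ha _
      obtain rfl : a = m := by omega
      simpa using intersectionLaw_self n a α hκ
    | succ k ih =>
      intro a ha ha0
      have hsplit : (k + 1 + 1) * (n - m) = (k + 1) * (n - m) + (n - m) := by ring
      have h1 := ih (a + (n - m)) (by omega) (by omega)
      have h2 := h1.inter (b := a) (by positivity)
        (div_le_self hκ.le (one_le_pow₀ (by norm_num))) hmn.le (by omega) ha0 (by omega) (by omega)
      rwa [div_div, ← pow_succ] at h2
  obtain ⟨k, rfl⟩ : ∃ k, q = k + 1 := ⟨q - 1, by omega⟩
  have hlawr := hlaw k r (by omega) hr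
  set κ' := κ / 2 ^ k with hκ'
  have hκ'0 : 0 < κ' := by positivity
  have hκ'κ : κ' / n ≤ κ := by
    refine (div_le_self hκ'0.le (by exact_mod_cast hn0)).trans ?_
    exact div_le_self hκ.le (one_le_pow₀ (by norm_num))
  have hκ'n : 0 < κ' / n := div_pos hκ'0 (by exact_mod_cast hn0)
  obtain ⟨ε₂, hε₂, hlarge⟩ := h.exists_large_subset hα hαn hκ'n
  obtain ⟨ε₀, hε₀, hν⟩ := hlawr (ε₂ / 2) (half_pos hε₂)
  obtain ⟨C, hC⟩ := exists_measure_Vang_le n hn0 hκ'0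
  set ε := min (ε₀ / 2) ε₂ with hε
  have hεε₀ : ε ≤ ε₀ / 2 := min_le_left _ _
  have hεε₂ : ε ≤ ε₂ := min_le_right _ _
  have hε0 : 0 < ε := lt_min (by positivity) hε₂
  have hev : ∀ᶠ δ : ℝ in 𝓝[>] 0,
      ∀ (A : Set (E n)) (μ : Measure (Gr n m)), A ⊆ Metric.closedBall 0 1 →
        IsProbabilityMeasure μ → δ ^ (-α + ε) ≤ (cov δ A : ℝ) →
        (∀ ρ : ℝ, δ ≤ ρ → ∀ x : E n,
          (cov δ (A ∩ Metric.closedBall x ρ) : ℝ) ≤ δ ^ (-ε) * ρ ^ κ * (cov δ A : ℝ)) →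
        (∀ ρ : ℝ, δ ≤ ρ → ∀ W : Gr n (n - m),
          μ (Vang W ρ) ≤ ENNReal.ofReal (δ ^ (-ε) * ρ ^ κ)) →
        ∃ A' ⊆ A, μ (exceptional n m α ε δ A') ≤ ENNReal.ofReal (δ ^ ε) := by
    filter_upwards [eventually_pos_lt_one, hlarge, hν,
      eventually_le_rpow_neg C (half_pos hε₂),
      eventually_le_rpow_neg (2 * (2 * n + 1) ^ n) (half_pos hε₀)]
      with δ ⟨hδ, hδ1⟩ hlargeδ hνδ hCδ hPδ A μ hA hμ hcov hfrost hang
    have hmono : ∀ {s t : ℝ}, s ≤ t → δ ^ t ≤ δ ^ s := fun hst =>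
      Real.rpow_le_rpow_of_exponent_ge hδ hδ1.le hst
    have hAb : Bornology.IsBounded A := Metric.isBounded_closedBall.subset hA
    by_contra! hcon
    obtain ⟨ν, hνprob, hνconc, hνexc⟩ := hνδ μ hμ fun ρ hρ W => by
      have hρ0 : 0 < ρ := hδ.trans_le hρ
      refine (hang ρ hρ W).trans (ENNReal.ofReal_le_ofReal ?_)
      gcongr ?_ * _
      exact hmono (by linarith)
    have hνang : ∀ ρ : ℝ, δ ≤ ρ → ∀ W : Gr n (n - r),
        ν (Vang W ρ) ≤ ENNReal.ofReal (δ ^ (-ε₂) * ρ ^ (κ' / n)) := by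
      intro ρ hρ W
      have hρ0 : 0 < ρ := hδ.trans_le hρ
      refine (hC r δ (ε₂ / 2) hδ hδ1 (half_pos hε₂) ν hνprob hνconc ρ hρ W).trans
        (ENNReal.ofReal_le_ofReal ?_)
      gcongr ?_ * _
      calc C * δ ^ (-(ε₂ / 2)) ≤ δ ^ (-(ε₂ / 2)) * δ ^ (-(ε₂ / 2)) := by gcongr
        _ = δ ^ (-ε₂) := by rw [← Real.rpow_add hδ]; ring_nf
    have hfrost' : ∀ ρ : ℝ, δ ≤ ρ → ∀ x : E n, (cov δ (A ∩ Metric.closedBall x ρ) : ℝ) ≤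
        δ ^ (-ε₂) * ρ ^ (κ' / n) * (cov δ A : ℝ) := by
      intro ρ hρ x
      have hρ0 : 0 < ρ := hδ.trans_le hρ
      rcases le_or_gt ρ 1 with hρ1 | hρ1
      · refine (hfrost ρ hρ x).trans ?_
        gcongr ?_ * ?_ * _
        · exact hmono (by linarith)
        · exact Real.rpow_le_rpow_of_exponent_ge hρ0 hρ1 hκ'κ
      · have h1 : (cov δ (A ∩ Metric.closedBall x ρ) : ℝ) ≤ cov δ A := by
          exact_mod_cast cov_mono hδ Set.inter_subset_left hAb
        refine h1.trans (le_mul_of_one_le_left (by positivity) ?_)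
        exact one_le_mul_of_one_le_of_one_le
          (Real.one_le_rpow_of_pos_of_le_one_of_nonpos hδ hδ1.le (by linarith))
          (Real.one_le_rpow hρ1.le hκ'n.le)
    obtain ⟨A', hA'A, hA'large, hA'exc⟩ := hlargeδ A ν hA hνprob
      ((hmono (by linarith)).trans hcov) hfrost' hνang
    have hcov' : δ ^ (-α + ε₀) ≤ (cov δ A' : ℝ) := by
      have h1 : δ ^ (-α + ε) ≤ δ ^ (-(ε₀ / 2)) * cov δ A' :=
        hcov.trans (hA'large.trans (by gcongr))
      calc δ ^ (-α + ε₀) ≤ δ ^ (ε₀ / 2 + (-α + ε)) := hmono (by linarith)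
        _ = δ ^ (ε₀ / 2) * δ ^ (-α + ε) := Real.rpow_add hδ _ _
        _ ≤ δ ^ (ε₀ / 2) * (δ ^ (-(ε₀ / 2)) * cov δ A') := by gcongr
        _ = cov δ A' := by rw [← mul_assoc, ← Real.rpow_add hδ]; simp
    have h1 : ENNReal.ofReal (δ ^ (ε₂ / 2)) ≤ ν (exceptional n r α (ε₂ / 2) δ A') := by
      refine hνexc A hA (fun B hB => ?_) A' hA'A hcov'
      exact (ENNReal.ofReal_le_ofReal (hmono (by linarith))).trans ((hcon B hB).le.trans
        (measure_mono (exceptional_mono hδ hδ1 (by linarith) B)))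
    have h2 := h1.trans ((measure_mono (exceptional_mono hδ hδ1 (by linarith) A')).trans hA'exc)
    rw [ENNReal.ofReal_le_ofReal_iff (by positivity)] at h2
    exact absurd h2 (not_le.2 (Real.rpow_lt_rpow_of_exponent_gt hδ hδ1 (by linarith)))
  obtain ⟨δ₀, hδ₀, hδ₀'⟩ := mem_nhdsGT_iff_exists_Ioo_subset.1 hev
  exact ⟨ε, hε0, δ₀, hδ₀, fun δ hδ hδδ₀ => hδ₀' ⟨hδ, hδδ₀⟩⟩
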